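/- Let $m=(m_0,m_1,\dots)$ be a bounded sequence of integers $m_k\ge 2$, let $G_m=\prod_{k\ge0}\mathbb Z_{m_k}$ be the corresponding (bounded) Vilenkin group and $\mu$ its normalized Haar measure, i.e. the product of the uniform probability measures on the factors $\mathbb Z_{m_k}=\{0,\dots,m_k-1\}$. Put $M_0=1$, $M_{k+1}=m_kM_k$, write $n=\sum_k n_kM_k$ with digits $0\le n_k<m_k$, and let $\psi_n(x)=\prod_k r_k(x)^{n_k}$ with $r_k(x)=\exp(2\pi i x_k/m_k)$ be the Vilenkin system. For $f\in L_1(G_m)$ let $\widehat f(n)=\int_{G_m}f\,\overline{\psi_n}\,d\mu$ and $S_nf=\sum_{k=0}^{n-1}\widehat f(k)\psi_k$. For a sequence $q=(q_k)_{k\ge0}$ of non-negative numbers put $Q_n=\sum_{k=0}^{n-1}q_k$; the Nörlund means generated by $q$ are $t_nf=\frac1{Q_n}\sum_{k=1}^nq_{n-k}S_kf$, for those $n$ with $Q_n>0$ (in the cases below, all large $n$). Let $1\le p\le\infty$ and let $f\in L_p(G_m)$ be complex-valued. Then each of the following converges to $f(x)$ for $\mu$-almost every $x\in G_m$ as $n\to\infty$: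 1. the Fejér means $\sigma_nf=\frac1n\sum_{k=1}^nS_kf$; 2. for every $0<\alpha<1$, the Cesàro means $\sigma_n^\alpha f=\frac1{A_n^\alpha}\sum_{k=1}^nA_{n-k}^{\alpha-1}S_kf$, where $A_n^{\gamma}=\frac{(\gamma+1)\cdots(\gamma+n)}{n!}$ for $n\ge1$, both with the usual value $A_0^\gamma=1$ and with the convention $A_0^\gamma=0$; 3. for every $0<\alpha<1$, the means $V_n^\alpha f=\frac1{Q_n}\sum_{k=0}^{n-1}(n-k)^{\alpha-1}S_kf$, where $Q_n$ is formed from $q_0=1$, $q_k=k^{\alpha-1}$ $(k\ge1)$, and likewise the Nörlund means generated by this sequence $q$; 4. for every real $\alpha>0$ and every integer $\beta\ge1$, the means $B_n^{\alpha,\beta}f=\frac1{Q_n}\sum_{k=1}^n\log^{(\beta)}(n^\alpha-k^\alpha)\,S_kf$, where $Q_n$ is formed from $q_0=0$, $q_k=\log^{(\beta)}k^\alpha$ $(k\ge1)$, and likewise the Nörlund means generated by this sequence $q$. Here $\log^{(\beta)}x$ is the $\beta$-fold iterated logarithm where this is defined and non-negative, and $0$ for all other $x\ge0$. -/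

import Mathlib

open MeasureTheory ProbabilityTheory Filter Topology
open scoped ENNReal

noncomputable section

namespace Vilenkin

/-- The Vilenkin group `G_m`, the complete direct product of the cyclic groups `Z_{m_k}`. -/
abbrev Gm (m : ℕ → ℕ) : Type := ∀ k : ℕ, ZMod (m k)

/-- The normalized Haar measure of `G_m`: the product of the uniform probability measures
on the factors `Z_{m_k}`. -/
def haar (m : ℕ → ℕ) : Measure (Gm m) :=
  Measure.infinitePi fun k => uniformOn (Set.univ : Set (ZMod (m k)))

/-- `M_0 = 1`, `M_{k+1} = m_k M_k`. -/
def M (m : ℕ → ℕ) (k : ℕ) : ℕ := ∏ j ∈ Finset.range k, m j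

/-- The `k`-th digit `n_k ∈ {0, …, m_k - 1}` of `n = ∑ n_k M_k`. -/
def digit (m : ℕ → ℕ) (n k : ℕ) : ℕ := n / M m k % m k

/-- The generalized Rademacher functions `r_k(x) = exp(2πi x_k / m_k)`. -/
def rademacher (m : ℕ → ℕ) (k : ℕ) (x : Gm m) : ℂ :=
  Complex.exp (2 * Real.pi * Complex.I * ((x k).val : ℂ) / (m k : ℂ))

/-- The Vilenkin functions `ψ_n = ∏_k r_k ^ n_k`. The product is cut at `k < n`, since
all digits `n_k` with `k ≥ n` vanish (see `digit_eq_zero`). -/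
def psi (m : ℕ → ℕ) (n : ℕ) (x : Gm m) : ℂ :=
  ∏ k ∈ Finset.range n, rademacher m k x ^ digit m n k

/-- The Vilenkin–Fourier coefficients. -/
def fourierCoeff (m : ℕ → ℕ) (f : Gm m → ℂ) (n : ℕ) : ℂ :=
  ∫ x, f x * (starRingEnd ℂ) (psi m n x) ∂(haar m)

/-- The partial sums `S_n f = ∑_{k < n} \hat f(k) ψ_k`. -/
def partialSum (m : ℕ → ℕ) (n : ℕ) (f : Gm m → ℂ) (x : Gm m) : ℂ :=
  ∑ k ∈ Finset.range n, fourierCoeff m f k * psi m k x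

/-- The Fejér means `σ_n f = (1/n) ∑_{k=1}^n S_k f`. -/
def fejerMean (m : ℕ → ℕ) (n : ℕ) (f : Gm m → ℂ) (x : Gm m) : ℂ :=
  (∑ k ∈ Finset.Icc 1 n, partialSum m k f x) / (n : ℂ)

/-- `Q_n = ∑_{k < n} q_k`. -/
def sumQ (q : ℕ → ℝ) (n : ℕ) : ℝ := ∑ k ∈ Finset.range n, q k

/-- The Nörlund means `t_n f = (1/Q_n) ∑_{k=1}^n q_{n-k} S_k f` generated by `q`. -/
def norlundMean (m : ℕ → ℕ) (q : ℕ → ℝ) (n : ℕ) (f : Gm m → ℂ) (x : Gm m) : ℂ :=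
  (∑ k ∈ Finset.Icc 1 n, (q (n - k) : ℂ) * partialSum m k f x) / (sumQ q n : ℂ)

/-- The Cesàro numbers `A_n^α = (α+1)⋯(α+n)/n!` for `n ≥ 1`, with `A_0^α = a₀`. The usual value
is `a₀ = 1`; the convention `a₀ = 0` also occurs. -/
def cesaroNumber (a₀ α : ℝ) (n : ℕ) : ℝ :=
  if n = 0 then a₀ else (∏ j ∈ Finset.Icc 1 n, (α + j)) / (n.factorial : ℝ)

/-- The Cesàro means `σ_n^α f = (1/A_n^α) ∑_{k=1}^n A_{n-k}^{α-1} S_k f`. -/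
def cesaroMean (m : ℕ → ℕ) (a₀ α : ℝ) (n : ℕ) (f : Gm m → ℂ) (x : Gm m) : ℂ :=
  (∑ k ∈ Finset.Icc 1 n, (cesaroNumber a₀ (α - 1) (n - k) : ℂ) * partialSum m k f x) /
    (cesaroNumber a₀ α n : ℂ)

/-- `q_0 = 1`, `q_k = k^{α-1}` for `k ≥ 1`. -/
def qV (α : ℝ) (k : ℕ) : ℝ := if k = 0 then 1 else (k : ℝ) ^ (α - 1)

/-- `V_n^α f = (1/Q_n) ∑_{k=0}^{n-1} (n-k)^{α-1} S_k f`, with `Q_n` formed from `qV α`. It differs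
from the Nörlund mean generated by `qV α` only in the term `k = n`. -/
def VMean (m : ℕ → ℕ) (α : ℝ) (n : ℕ) (f : Gm m → ℂ) (x : Gm m) : ℂ :=
  (∑ k ∈ Finset.range n, ((((n : ℝ) - (k : ℝ)) ^ (α - 1) : ℝ) : ℂ) * partialSum m k f x) /
    (sumQ (qV α) n : ℂ)

/-- The `β`-fold iterated logarithm `log^{(β)} x = log ⋯ log x` of `x ≥ 0`, truncated below: it is
`0` where the iterated logarithm is undefined or negative (if one of the successive logarithms
is not positive, then all the later truncated ones are `0`). -/
def iterLog (β : ℕ) (x : ℝ) : ℝ := Real.posLog^[β] x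

/-- `q_0 = 0`, `q_k = log^{(β)} k^α` for `k ≥ 1`. -/
def qB (α : ℝ) (β k : ℕ) : ℝ := if k = 0 then 0 else iterLog β ((k : ℝ) ^ α)

/-- `B_n^{α,β} f = (1/Q_n) ∑_{k=1}^n log^{(β)}(n^α - k^α) S_k f`, with `Q_n` formed from
`qB α β`. -/
def BMean (m : ℕ → ℕ) (α : ℝ) (β n : ℕ) (f : Gm m → ℂ) (x : Gm m) : ℂ :=
  (∑ k ∈ Finset.Icc 1 n,
      (iterLog β ((n : ℝ) ^ α - (k : ℝ) ^ α) : ℂ) * partialSum m k f x) /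
    (sumQ (qB α β) n : ℂ)

theorem lt_M (m : ℕ → ℕ) (hm : ∀ k, 2 ≤ m k) (k : ℕ) : k < M m k := by
  have h : 2 ^ k ≤ M m k := by
    have := Finset.prod_le_prod' (s := Finset.range k) (f := fun _ => 2) (g := m)
      fun i _ => hm i
    simpa [M] using this
  exact k.lt_two_pow_self.trans_le h

theorem digit_eq_zero (m : ℕ → ℕ) (hm : ∀ k, 2 ≤ m k) {n k : ℕ} (h : n ≤ k) :
    digit m n k = 0 := by
  rw [digit, Nat.div_eq_of_lt (h.trans_lt (lt_M m hm k)), Nat.zero_mod]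

/-- The factor measures have total mass one, so that `haar m` is the genuine product measure. -/
theorem isProbabilityMeasure_factor (m : ℕ → ℕ) (hm : ∀ k, 2 ≤ m k) (k : ℕ) :
    IsProbabilityMeasure (uniformOn (Set.univ : Set (ZMod (m k)))) := by
  have : NeZero (m k) := ⟨by have := hm k; omega⟩
  exact isProbabilityMeasure_uniformOn Set.finite_univ Set.univ_nonempty

end Vilenkin

end

/-!
The `n`-th Nörlund sum of `f` is the convolution of `f` with `F_n = ∑_{k=1}^n q_{n-k} D_k`, where
`D_k = ∑_{i<k} ψ_i`. The pointwise size of `F_n` follows from two cancellations alone. If `z_t ≠ 0`,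
then `∑ ψ_i(z)` vanishes over aligned blocks of length `M_{t+1}`, so that `|D_k(z)| ≤ M_{t+1}`; if
moreover `z_u ≠ 0` for some `u > t`, then `∑ D_k(z)` vanishes over aligned blocks of length
`M_{u+1}`. For weights which are nonincreasing from `q_1` on, with `Q_n = O(n^α)`, Abel summation
gives `|F_n(z)| = O(M_t M_u^α)`, where `t < u` are the positions of the first two nonzero coordinates
of `z` (`exists_norm_norlundKernel_le`).

Consequently, for `M_N ≤ n < M_{N+1}`, the sum divided by `n^α` is at most a constant times
`∑_{t ≤ j ≤ N} 2^{-α(N-j)} 2^{-(j-t)} A_{j,t}|f|`, where `A_{j,t}h(x)` is essentially the average of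
`h` over the points which agree with `x` in the coordinates below `j` other than `t`. The operator
`sup_j A_{j,j-d}` is of weak type `(1,1)` with a constant growing only linearly in `d`
(`haar_slab_maximal_le`): the set where a coset average first exceeds a threshold at level `N` is
invariant under translations in the coordinates `t ≥ N`, and only the `d` coordinates
`N - d ≤ t < N` produce new points. Summation over `d` against `2^{-d}` yields the maximal inequality
`exists_haar_norlundSum_maximal_le`.

By Lévy's upward theorem the functions of finitely many coordinates are dense in `L_1`, and for these
`S_k g = g` for large `k`. The maximal inequality therefore gives almost everywhere convergence for
such weights as soon as `Q_n / n^α` has a limit (`ae_tendsto_norlundSum`). This covers the Fejér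
means, the Cesàro means and the means generated by `k^{α-1}`; the weight `q_0` plays no role. The
logarithmic means have weights decreasing in `k`, hence are averages of the Fejér means by Abel's
transformation, and converge wherever the Fejér means do (`tendsto_sum_mul_div_sumQ_qB`).
-/

namespace Vilenkin

/-! ### Digits and characters -/

section Characters

variable {m : ℕ → ℕ}

theorem M_pos (hm : ∀ k, 2 ≤ m k) (k : ℕ) : 0 < M m k := (Nat.zero_le k).trans_lt (lt_M m hm k)

theorem M_succ (k : ℕ) : M m (k + 1) = M m k * m k := by
  simp [M, Finset.prod_range_succ]

theorem M_dvd_M {i j : ℕ} (h : i ≤ j) : M m i ∣ M m j :=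
  Finset.prod_dvd_prod_of_subset _ _ _ (Finset.range_subset_range.2 h)

theorem M_mono (hm : ∀ k, 2 ≤ m k) {i j : ℕ} (h : i ≤ j) : M m i ≤ M m j :=
  Nat.le_of_dvd (M_pos hm j) (M_dvd_M h)

theorem two_pow_mul_M_le (hm : ∀ k, 2 ≤ m k) (i d : ℕ) : 2 ^ d * M m i ≤ M m (i + d) := by
  induction d with
  | zero => simp
  | succ d ih =>
    rw [← add_assoc, M_succ, pow_succ]
    calc 2 ^ d * 2 * M m i = (2 ^ d * M m i) * 2 := by ring
      _ ≤ M m (i + d) * m (i + d) := Nat.mul_le_mul ih (hm _)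

theorem digit_eq_zero_of_lt {n k : ℕ} (h : n < M m k) : digit m n k = 0 := by
  rw [digit, Nat.div_eq_of_lt h, Nat.zero_mod]

theorem digit_mul_of_lt (hm : ∀ k, 2 ≤ m k) {i k : ℕ} (a : ℕ) (h : k < i) :
    digit m (a * M m i) k = 0 := by
  obtain ⟨c, hc⟩ := M_dvd_M (m := m) (Nat.succ_le_of_lt h)
  have : a * M m i = M m k * (m k * (a * c)) := by
    rw [hc, Nat.succ_eq_add_one, M_succ]; ring
  rw [digit, this, Nat.mul_div_cancel_left _ (M_pos hm k), Nat.mul_mod_right]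

/-- There is no carry when a number below `M_i` is added to a multiple of `M_i`. -/
theorem digit_mul_add (hm : ∀ k, 2 ≤ m k) {i b : ℕ} (a : ℕ) (hb : b < M m i) (k : ℕ) :
    digit m (a * M m i + b) k = digit m (a * M m i) k + digit m b k := by
  rcases lt_or_ge k i with h | h
  · rw [digit_mul_of_lt hm a h, zero_add]
    obtain ⟨c, hc⟩ := M_dvd_M (m := m) (Nat.succ_le_of_lt h)
    have : a * M m i + b = b + M m k * (m k * (a * c)) := by
      rw [hc, Nat.succ_eq_add_one, M_succ]; ring
    rw [digit, digit, this, Nat.add_mul_div_left _ _ (M_pos hm k), Nat.add_mul_mod_self_left]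
  · rw [digit_eq_zero_of_lt (hb.trans_le (M_mono hm h)), add_zero]
    obtain ⟨c, hc⟩ := M_dvd_M (m := m) h
    rw [digit, digit, hc, ← Nat.div_div_eq_div_mul, ← Nat.div_div_eq_div_mul,
      Nat.mul_div_cancel _ (M_pos hm i), mul_comm a, Nat.mul_add_div (M_pos hm i),
      Nat.div_eq_of_lt hb, add_zero]

theorem digit_mul_self (hm : ∀ k, 2 ≤ m k) {i s : ℕ} (hs : s < m i) (k : ℕ) :
    digit m (s * M m i) k = if k = i then s else 0 := by
  split_ifs with h
  · subst h
    rw [digit, Nat.mul_div_cancel _ (M_pos hm k), Nat.mod_eq_of_lt hs]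
  · rcases lt_or_gt_of_ne h with h | h
    · exact digit_mul_of_lt hm s h
    · refine digit_eq_zero_of_lt (lt_of_lt_of_le ?_ (M_mono hm (Nat.succ_le_of_lt h)))
      rw [Nat.succ_eq_add_one, M_succ, mul_comm]
      exact Nat.mul_lt_mul_of_pos_left hs (M_pos hm i)

theorem rademacher_eq (hm : ∀ k, 2 ≤ m k) (k : ℕ) (x : Gm m) :
    haveI : NeZero (m k) := ⟨by have := hm k; omega⟩
    rademacher m k x = ZMod.toCircle (x k) := by
  have : NeZero (m k) := ⟨by have := hm k; omega⟩
  rw [ZMod.toCircle_apply, rademacher]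

theorem rademacher_add (hm : ∀ k, 2 ≤ m k) (k : ℕ) (x y : Gm m) :
    rademacher m k (x + y) = rademacher m k x * rademacher m k y := by
  have : NeZero (m k) := ⟨by have := hm k; omega⟩
  simp only [rademacher_eq hm, Pi.add_apply, AddChar.map_add_eq_mul, Circle.coe_mul]

theorem norm_rademacher (hm : ∀ k, 2 ≤ m k) (k : ℕ) (x : Gm m) : ‖rademacher m k x‖ = 1 := by
  have : NeZero (m k) := ⟨by have := hm k; omega⟩
  rw [rademacher_eq hm, Circle.norm_coe]

theorem rademacher_eq_one_iff (hm : ∀ k, 2 ≤ m k) (k : ℕ) (x : Gm m) :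
    rademacher m k x = 1 ↔ x k = 0 := by
  have : NeZero (m k) := ⟨by have := hm k; omega⟩
  rw [rademacher_eq hm, Circle.coe_eq_one, ← AddChar.map_zero_eq_one (ZMod.toCircle (N := m k)),
    ZMod.injective_toCircle.eq_iff]

theorem rademacher_pow_m (hm : ∀ k, 2 ≤ m k) (k : ℕ) (x : Gm m) :
    rademacher m k x ^ m k = 1 := by
  have : NeZero (m k) := ⟨by have := hm k; omega⟩
  rw [rademacher_eq hm, ← Circle.coe_pow, ← AddChar.map_nsmul_eq_pow]
  simp

theorem sum_rademacher_pow_eq_zero (hm : ∀ k, 2 ≤ m k) {k : ℕ} {x : Gm m} (hx : x k ≠ 0) :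
    ∑ s ∈ Finset.range (m k), rademacher m k x ^ s = 0 := by
  have h1 : rademacher m k x ≠ 1 := fun h => hx ((rademacher_eq_one_iff hm k x).1 h)
  rw [geom_sum_eq h1, rademacher_pow_m hm, sub_self, zero_div]

theorem psi_eq_prod (hm : ∀ k, 2 ≤ m k) {n L : ℕ} (h : n ≤ L) (x : Gm m) :
    psi m n x = ∏ k ∈ Finset.range L, rademacher m k x ^ digit m n k := by
  refine Finset.prod_subset (Finset.range_subset_range.2 h) fun k _ hk => ?_
  rw [digit_eq_zero m hm (by simpa using hk), pow_zero]

theorem psi_mul_add (hm : ∀ k, 2 ≤ m k) {i b : ℕ} (a : ℕ) (hb : b < M m i) (x : Gm m) :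
    psi m (a * M m i + b) x = psi m (a * M m i) x * psi m b x := by
  rw [psi, psi_eq_prod hm (Nat.le_add_right (a * M m i) b),
    psi_eq_prod hm (Nat.le_add_left b (a * M m i)), ← Finset.prod_mul_distrib]
  refine Finset.prod_congr rfl fun k _ => ?_
  rw [digit_mul_add hm a hb, pow_add]

theorem psi_mul_M (hm : ∀ k, 2 ≤ m k) {i s : ℕ} (hs : s < m i) (x : Gm m) :
    psi m (s * M m i) x = rademacher m i x ^ s := by
  rw [psi_eq_prod hm (le_max_left _ (i + 1)), Finset.prod_eq_single i]
  · rw [digit_mul_self hm hs, if_pos rfl]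
  · intro k _ hk
    rw [digit_mul_self hm hs, if_neg hk, pow_zero]
  · simp

theorem psi_add (hm : ∀ k, 2 ≤ m k) (n : ℕ) (x y : Gm m) :
    psi m n (x + y) = psi m n x * psi m n y := by
  simp only [psi, rademacher_add hm, mul_pow, Finset.prod_mul_distrib]

theorem norm_psi (hm : ∀ k, 2 ≤ m k) (n : ℕ) (x : Gm m) : ‖psi m n x‖ = 1 := by
  simp [psi, norm_rademacher hm]

theorem psi_eq_one (hm : ∀ k, 2 ≤ m k) {n N : ℕ} (hn : n < M m N) {x : Gm m}
    (hx : ∀ i < N, x i = 0) : psi m n x = 1 := by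
  refine Finset.prod_eq_one fun k _ => ?_
  rcases lt_or_ge k N with h | h
  · rw [(rademacher_eq_one_iff hm k x).2 (hx k h), one_pow]
  · rw [digit_eq_zero_of_lt (hn.trans_le (M_mono hm h)), pow_zero]

theorem psi_sub (hm : ∀ k, 2 ≤ m k) (n : ℕ) (x y : Gm m) :
    psi m n (x - y) = psi m n x * (starRingEnd ℂ) (psi m n y) := by
  have h : psi m n x = psi m n (x - y) * psi m n y := by rw [← psi_add hm, sub_add_cancel]
  rw [h, mul_assoc, Complex.mul_conj, Complex.normSq_eq_norm_sq, norm_psi hm]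
  simp

/-- A sequence whose sums over the aligned blocks of length `W` vanish has bounded partial sums. -/
theorem norm_sum_range_le_of_blocks {g : ℕ → ℂ} {W : ℕ} (hW : 0 < W) {b : ℝ}
    (hb : ∀ i, ‖g i‖ ≤ b) (h0 : ∀ c, ∑ i ∈ Finset.range W, g (c * W + i) = 0) (n : ℕ) :
    ‖∑ i ∈ Finset.range n, g i‖ ≤ W * b := by
  have hblock : ∀ c, ∑ i ∈ Finset.range (c * W), g i = 0 := by
    intro c
    induction c with
    | zero => simp
    | succ c ih => rw [Nat.succ_mul, Finset.sum_range_add, ih, h0, add_zero]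
  have hb0 : 0 ≤ b := (norm_nonneg _).trans (hb 0)
  rw [← Nat.div_add_mod' n W, Finset.sum_range_add, hblock, zero_add]
  calc ‖∑ i ∈ Finset.range (n % W), g (n / W * W + i)‖
      ≤ ∑ i ∈ Finset.range (n % W), b := norm_sum_le_of_le _ fun i _ => hb _
    _ = (n % W : ℕ) * b := by simp
    _ ≤ W * b := by gcongr; exact (Nat.mod_lt n hW).le

/-! ### The Dirichlet kernels -/

/-- The Dirichlet kernel `D_n = ∑_{k < n} ψ_k`. -/
noncomputable def dirichletKernel (m : ℕ → ℕ) (n : ℕ) (z : Gm m) : ℂ := ∑ k ∈ Finset.range n, psi m k z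

theorem norm_dirichletKernel_le (hm : ∀ k, 2 ≤ m k) (n : ℕ) (z : Gm m) :
    ‖dirichletKernel m n z‖ ≤ n := by
  refine (norm_sum_le _ _).trans ?_
  simp [norm_psi hm]

theorem dirichletKernel_mul_add (hm : ∀ k, 2 ≤ m k) {i b : ℕ} (a : ℕ) (hb : b ≤ M m i)
    (z : Gm m) : dirichletKernel m (a * M m i + b) z =
      dirichletKernel m (a * M m i) z + psi m (a * M m i) z * dirichletKernel m b z := by
  rw [dirichletKernel, Finset.sum_range_add, dirichletKernel, dirichletKernel, Finset.mul_sum]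
  congr 1
  refine Finset.sum_congr rfl fun k hk => psi_mul_add hm a ?_ z
  exact (Finset.mem_range.1 hk).trans_le hb

theorem dirichletKernel_mul_M (hm : ∀ k, 2 ≤ m k) (i a : ℕ) (z : Gm m) :
    dirichletKernel m (a * M m i) z =
      (∑ c ∈ Finset.range a, psi m (c * M m i) z) * dirichletKernel m (M m i) z := by
  induction a with
  | zero => simp [dirichletKernel]
  | succ a ih => rw [Nat.succ_mul, dirichletKernel_mul_add hm a le_rfl, ih, Finset.sum_range_succ,
      add_mul]

theorem dirichletKernel_M_eq_zero (hm : ∀ k, 2 ≤ m k) {t j : ℕ} (h : t < j) {z : Gm m}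
    (hz : z t ≠ 0) : dirichletKernel m (M m j) z = 0 := by
  have h1 : dirichletKernel m (M m (t + 1)) z = 0 := by
    rw [M_succ, mul_comm, dirichletKernel_mul_M hm,
      Finset.sum_congr rfl fun s hs => psi_mul_M hm (Finset.mem_range.1 hs) z,
      sum_rademacher_pow_eq_zero hm hz, zero_mul]
  obtain ⟨c, hc⟩ := M_dvd_M (m := m) (Nat.succ_le_of_lt h)
  rw [hc, mul_comm, dirichletKernel_mul_M hm, h1, mul_zero]

theorem dirichletKernel_mul_M_eq_zero (hm : ∀ k, 2 ≤ m k) {t j : ℕ} (h : t < j) {z : Gm m}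
    (hz : z t ≠ 0) (a : ℕ) : dirichletKernel m (a * M m j) z = 0 := by
  rw [dirichletKernel_mul_M hm, dirichletKernel_M_eq_zero hm h hz, mul_zero]

theorem dirichletKernel_M_eq (hm : ∀ k, 2 ≤ m k) {N : ℕ} {z : Gm m} (hz : ∀ i < N, z i = 0) :
    dirichletKernel m (M m N) z = M m N := by
  rw [dirichletKernel,
    Finset.sum_congr rfl fun k hk => psi_eq_one hm (Finset.mem_range.1 hk) hz]
  simp

theorem dirichletKernel_mul_add_of_ne (hm : ∀ k, 2 ≤ m k) {t j b : ℕ} (h : t < j) {z : Gm m}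
    (hz : z t ≠ 0) (a : ℕ) (hb : b ≤ M m j) :
    dirichletKernel m (a * M m j + b) z = psi m (a * M m j) z * dirichletKernel m b z := by
  rw [dirichletKernel_mul_add hm a hb, dirichletKernel_mul_M_eq_zero hm h hz, zero_add]

/-- The Dirichlet kernels are uniformly bounded off `I_{t+1}`. -/
theorem norm_dirichletKernel_le_of_ne (hm : ∀ k, 2 ≤ m k) {t : ℕ} {z : Gm m} (hz : z t ≠ 0)
    (n : ℕ) : ‖dirichletKernel m n z‖ ≤ M m (t + 1) := by
  have := norm_sum_range_le_of_blocks (g := fun k => psi m k z) (M_pos hm (t + 1)) (b := 1)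
    (fun i => (norm_psi hm i z).le) (fun c => ?_) n
  · simpa [dirichletKernel] using this
  · rw [Finset.sum_congr rfl fun i hi => psi_mul_add hm c (Finset.mem_range.1 hi) z,
      ← Finset.mul_sum]
    exact mul_eq_zero_of_right _ (dirichletKernel_M_eq_zero hm t.lt_succ_self hz)

/-- At a point with two nonzero coordinates `t < u` the sums of the Dirichlet kernels over the
aligned blocks of length `M_{u+1}` vanish: the coordinate `t` makes `D_k` multiplicative across
blocks of length `M_u`, and the coordinate `u` contributes a full sum of roots of unity. -/
theorem norm_sum_dirichletKernel_le (hm : ∀ k, 2 ≤ m k) {t u : ℕ} (htu : t < u) {z : Gm m}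
    (ht : z t ≠ 0) (hu : z u ≠ 0) (n : ℕ) :
    ‖∑ k ∈ Finset.range n, dirichletKernel m k z‖ ≤ M m (u + 1) * M m (t + 1) := by
  have h0 : ∀ s : ℕ, ∑ k ∈ Finset.range (s * M m u), dirichletKernel m k z =
      (∑ c ∈ Finset.range s, psi m (c * M m u) z) *
        ∑ k ∈ Finset.range (M m u), dirichletKernel m k z := by
    intro s
    induction s with
    | zero => simp
    | succ s ih =>
      rw [Nat.succ_mul, Finset.sum_range_add, ih, Finset.sum_range_succ, add_mul]
      congr 1
      rw [Finset.mul_sum]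
      exact Finset.sum_congr rfl fun k hk =>
        dirichletKernel_mul_add_of_ne hm htu ht s (Finset.mem_range.1 hk).le
  refine norm_sum_range_le_of_blocks (M_pos hm (u + 1))
    (norm_dirichletKernel_le_of_ne hm ht) (fun c => ?_) n
  rw [Finset.sum_congr rfl fun i hi => dirichletKernel_mul_add_of_ne hm
    (htu.trans u.lt_succ_self) ht c (Finset.mem_range.1 hi).le, ← Finset.mul_sum]
  refine mul_eq_zero_of_right _ ?_
  rw [M_succ, mul_comm, h0,
    Finset.sum_congr rfl fun s hs => psi_mul_M hm (Finset.mem_range.1 hs) z,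
    sum_rademacher_pow_eq_zero hm hu, zero_mul]

end Characters

/-! ### Kernels of summation methods with monotone weights -/

section Kernels

variable {m : ℕ → ℕ} {q : ℕ → ℝ}

theorem sumQ_mono (hq0 : ∀ k, 0 ≤ q k) : Monotone (sumQ q) := fun _ _ h =>
  Finset.sum_le_sum_of_subset_of_nonneg (Finset.range_subset_range.2 h) fun _ _ _ => hq0 _

theorem sumQ_nonneg (hq0 : ∀ k, 0 ≤ q k) (n : ℕ) : 0 ≤ sumQ q n :=
  Finset.sum_nonneg fun _ _ => hq0 _

theorem natCast_mul_le_sumQ (hq0 : ∀ k, 0 ≤ q k) (hq : ∀ i j, 1 ≤ i → i ≤ j → q j ≤ q i)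
    (W : ℕ) : W * q W ≤ sumQ q (W + 1) := by
  rw [sumQ, Finset.sum_range_succ']
  have : ∑ i ∈ Finset.range W, q W ≤ ∑ i ∈ Finset.range W, q (i + 1) :=
    Finset.sum_le_sum fun i hi => hq _ _ (by omega) (by have := Finset.mem_range.1 hi; omega)
  rw [Finset.sum_const, Finset.card_range, nsmul_eq_mul] at this
  linarith [hq0 0]

/-- Abel's inequality for nondecreasing nonnegative weights. -/
theorem norm_sum_mul_le_of_monotone {w : ℕ → ℝ} {g : ℕ → ℂ} {K : ℕ} {b : ℝ}
    (hw0 : 0 ≤ w 0) (hw : ∀ k < K, w k ≤ w (k + 1))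
    (hg : ∀ n, ‖∑ k ∈ Finset.range n, g k‖ ≤ b) :
    ‖∑ k ∈ Finset.range (K + 1), (w k : ℂ) * g k‖ ≤ 2 * (w K * b) := by
  set G : ℕ → ℂ := fun n => ∑ k ∈ Finset.range n, g k with hG
  have hb : 0 ≤ b := (norm_nonneg _).trans (hg 0)
  have key : ∀ J ≤ K, ‖∑ k ∈ Finset.range (J + 1), (w k : ℂ) * g k - w J * G (J + 1)‖ ≤
      (w J - w 0) * b ∧ w 0 ≤ w J := by
    intro J hJ
    induction J with
    | zero => simp [hG]
    | succ J ih =>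
      obtain ⟨ih1, ih2⟩ := ih (by omega)
      have hstep := hw J (by omega)
      refine ⟨?_, ih2.trans hstep⟩
      have hsplit : ∑ k ∈ Finset.range (J + 1 + 1), (w k : ℂ) * g k - w (J + 1) * G (J + 1 + 1) =
          (∑ k ∈ Finset.range (J + 1), (w k : ℂ) * g k - w J * G (J + 1)) -
            ((w (J + 1) - w J : ℝ) : ℂ) * G (J + 1) := by
        have : G (J + 1 + 1) = G (J + 1) + g (J + 1) := Finset.sum_range_succ _ _
        rw [Finset.sum_range_succ _ (J + 1), this]
        push_cast
        ring
      rw [hsplit]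
      refine (norm_sub_le _ _).trans ?_
      rw [norm_mul, Complex.norm_real, Real.norm_of_nonneg (sub_nonneg.2 hstep)]
      have := mul_le_mul_of_nonneg_left (hg (J + 1)) (sub_nonneg.2 hstep)
      linarith
  obtain ⟨h1, h2⟩ := key K le_rfl
  have h3 : ‖(w K : ℂ) * G (K + 1)‖ ≤ w K * b := by
    rw [norm_mul, Complex.norm_real, Real.norm_of_nonneg (hw0.trans h2)]
    exact mul_le_mul_of_nonneg_left (hg _) (hw0.trans h2)
  have h4 := norm_le_norm_sub_add (∑ k ∈ Finset.range (K + 1), (w k : ℂ) * g k)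
    (w K * G (K + 1))
  have h5 : 0 ≤ w 0 * b := mul_nonneg hw0 hb
  linarith

/-- The unnormalized Nörlund kernel `∑_{k=1}^n q_{n-k} D_k`. -/
noncomputable def norlundKernel (m : ℕ → ℕ) (q : ℕ → ℝ) (n : ℕ) (z : Gm m) : ℂ :=
  ∑ k ∈ Finset.Icc 1 n, (q (n - k) : ℂ) * dirichletKernel m k z

theorem sum_Icc_one_tsub {E : Type*} [AddCommMonoid E] (F : ℕ → E) (n : ℕ) :
    ∑ k ∈ Finset.Icc 1 n, F (n - k) = ∑ k ∈ Finset.range n, F k := by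
  rw [← Finset.sum_range_reflect, ← Finset.Ico_add_one_right_eq_Icc,
    Finset.sum_Ico_eq_sum_range]
  refine Finset.sum_congr (by simp) fun k _ => ?_
  congr 1
  omega

theorem norm_norlundKernel_le (hq0 : ∀ k, 0 ≤ q k) {n : ℕ} {z : Gm m} {b : ℝ}
    (hb : ∀ k ≤ n, ‖dirichletKernel m k z‖ ≤ b) : ‖norlundKernel m q n z‖ ≤ b * sumQ q n := by
  rw [sumQ, ← sum_Icc_one_tsub, Finset.mul_sum]
  refine norm_sum_le_of_le _ fun k hk => ?_
  rw [norm_mul, Complex.norm_real, Real.norm_of_nonneg (hq0 _), mul_comm b]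
  exact mul_le_mul_of_nonneg_left (hb k (Finset.mem_Icc.1 hk).2) (hq0 _)

/-- If the Dirichlet kernels at `z` are bounded by `b` and their partial sums by `W * b`, then only
the `W` largest weights contribute to the Nörlund kernel. -/
theorem norm_norlundKernel_le_of_sum_le (hq0 : ∀ k, 0 ≤ q k)
    (hq : ∀ i j, 1 ≤ i → i ≤ j → q j ≤ q i) {W : ℕ} (hW : 0 < W) {z : Gm m} {b : ℝ}
    (hb : ∀ k, ‖dirichletKernel m k z‖ ≤ b)
    (hs : ∀ k, ‖∑ i ∈ Finset.range k, dirichletKernel m i z‖ ≤ W * b) (n : ℕ) :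
    ‖norlundKernel m q n z‖ ≤ 3 * b * sumQ q (W + 1) := by
  have hb0 : 0 ≤ b := (norm_nonneg _).trans (hb 0)
  have hQ : sumQ q W ≤ sumQ q (W + 1) := sumQ_mono hq0 W.le_succ
  have hQ0 := sumQ_nonneg hq0 (W + 1)
  rcases lt_or_ge n W with h | h
  · have h1 := norm_norlundKernel_le (m := m) (z := z) (n := n) hq0 fun k _ => hb k
    have h2 : b * sumQ q n ≤ b * sumQ q (W + 1) :=
      mul_le_mul_of_nonneg_left (sumQ_mono hq0 (by omega)) hb0
    nlinarith [mul_nonneg hb0 hQ0]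
  · obtain ⟨K, rfl⟩ := Nat.exists_eq_add_of_le' h
    have hsplit : norlundKernel m q (K + W) z =
        ∑ k ∈ Finset.range (K + 1), (q (K + W - k) : ℂ) * dirichletKernel m k z +
        ∑ k ∈ Finset.Ico (K + 1) (K + W + 1), (q (K + W - k) : ℂ) * dirichletKernel m k z := by
      rw [Finset.sum_range_add_sum_Ico _ (by omega), Finset.sum_range_succ', norlundKernel,
        ← Finset.Ico_add_one_right_eq_Icc, Finset.sum_Ico_eq_sum_range]
      simp [dirichletKernel, add_comm 1]
    have h1 : ‖∑ k ∈ Finset.range (K + 1), (q (K + W - k) : ℂ) * dirichletKernel m k z‖ ≤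
        2 * (q (K + W - K) * (W * b)) :=
      norm_sum_mul_le_of_monotone (w := fun k => q (K + W - k)) (hq0 _)
        (fun k hk => hq _ _ (by omega) (by omega)) hs
    rw [Nat.add_sub_cancel_left] at h1
    have h2 : ‖∑ k ∈ Finset.Ico (K + 1) (K + W + 1),
        (q (K + W - k) : ℂ) * dirichletKernel m k z‖ ≤ b * sumQ q W := by
      have : sumQ q W = ∑ k ∈ Finset.Ico (K + 1) (K + W + 1), q (K + W - k) := by
        rw [Finset.sum_Ico_eq_sum_range, sumQ, ← Finset.sum_range_reflect]
        refine Finset.sum_congr (by congr 1; omega) fun k _ => ?_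
        congr 1
        omega
      rw [this, Finset.mul_sum]
      refine norm_sum_le_of_le _ fun k _ => ?_
      rw [norm_mul, Complex.norm_real, Real.norm_of_nonneg (hq0 _), mul_comm b]
      exact mul_le_mul_of_nonneg_left (hb k) (hq0 _)
    rw [hsplit]
    have h3 := mul_le_mul_of_nonneg_right (natCast_mul_le_sumQ hq0 hq W) hb0
    have h4 := mul_le_mul_of_nonneg_left hQ hb0
    refine (norm_add_le _ _).trans ?_
    nlinarith

/-- Pointwise bound of the Nörlund kernel with `Q_n = O(n^α)`. The set of `z` with `z_i = 0` for
all `i < j` other than `t` has measure of the order `1 / M_j`, so that the right-hand side is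
`n^α (M_j / M_N)^α (M_t / M_j)` times the density of the uniform distribution on that set. -/
theorem exists_norm_norlundKernel_le (hm : ∀ k, 2 ≤ m k) {B : ℕ} (hB : ∀ k, m k ≤ B)
    (hq0 : ∀ k, 0 ≤ q k) (hq : ∀ i j, 1 ≤ i → i ≤ j → q j ≤ q i) {α C : ℝ} (hα : 0 < α)
    (hC : ∀ n : ℕ, sumQ q n ≤ C * (n : ℝ) ^ α) {n N : ℕ} (hN : M m N ≤ n)
    (hn : n ≤ M m (N + 1)) (z : Gm m) :
    ∃ j ≤ N, ∃ t ≤ j, (∀ i < j, i ≠ t → z i = 0) ∧ ‖norlundKernel m q n z‖ ≤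
      3 * B * C * (2 * B : ℝ) ^ α * (n : ℝ) ^ α * ((M m j : ℝ) / M m N) ^ α * M m t := by
  have hB2 : (2 : ℝ) ≤ B := by exact_mod_cast (hm 0).trans (hB 0)
  have hBα : 1 ≤ (2 * B : ℝ) ^ α := Real.one_le_rpow (by linarith) hα.le
  have hMN : (0 : ℝ) < M m N := by exact_mod_cast M_pos hm N
  have hC0 : 0 ≤ C := by
    have := (sumQ_nonneg hq0 1).trans (hC 1)
    simpa using this
  have hnα : 0 ≤ (n : ℝ) ^ α := by positivity
  have hM : ∀ t, (M m (t + 1) : ℝ) ≤ B * M m t := fun t => by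
    rw [M_succ, mul_comm]
    exact_mod_cast Nat.mul_le_mul_right _ (hB t)
  -- the case in which only the trivial bound on the kernel is needed
  have triv : ∀ t, (∀ k ≤ n, ‖dirichletKernel m k z‖ ≤ B * M m t) →
      ‖norlundKernel m q n z‖ ≤
        3 * B * C * (2 * B : ℝ) ^ α * (n : ℝ) ^ α * ((M m N : ℝ) / M m N) ^ α * M m t := by
    intro t ht
    refine (norm_norlundKernel_le hq0 ht).trans ?_
    rw [div_self hMN.ne', Real.one_rpow, mul_one]
    calc (B * M m t : ℝ) * sumQ q n ≤ B * M m t * (C * (n : ℝ) ^ α) := by gcongr; exact hC n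
      _ = (B * C * (n : ℝ) ^ α * M m t) * 1 := by ring
      _ ≤ (B * C * (n : ℝ) ^ α * M m t) * (3 * (2 * B : ℝ) ^ α) := by gcongr; linarith
      _ = _ := by ring
  by_cases h0 : ∀ i < N, z i = 0
  · refine ⟨N, le_rfl, N, le_rfl, fun i hi _ => h0 i hi, triv N fun k hk => ?_⟩
    refine (norm_dirichletKernel_le hm k z).trans (le_trans ?_ (hM N))
    exact_mod_cast hk.trans hn
  push Not at h0
  obtain ⟨t, ⟨htN, ht⟩, htmin⟩ : ∃ t, (t < N ∧ z t ≠ 0) ∧ ∀ i < t, z i = 0 := by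
    refine ⟨Nat.find h0, Nat.find_spec h0, fun i hi => ?_⟩
    by_contra hne
    exact Nat.find_min h0 hi ⟨hi.trans (Nat.find_spec h0).1, hne⟩
  have hD := norm_dirichletKernel_le_of_ne hm ht
  by_cases h1 : ∀ i < N, i ≠ t → z i = 0
  · exact ⟨N, le_rfl, t, htN.le, h1, triv t fun k _ => (hD k).trans (hM t)⟩
  push Not at h1
  obtain ⟨u, ⟨huN, hut, hu⟩, humin⟩ :
      ∃ u, (u < N ∧ u ≠ t ∧ z u ≠ 0) ∧ ∀ i < u, i ≠ t → z i = 0 := by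
    refine ⟨Nat.find h1, Nat.find_spec h1, fun i hi hit => ?_⟩
    by_contra hne
    exact Nat.find_min h1 hi ⟨hi.trans (Nat.find_spec h1).1, hit, hne⟩
  have htu : t < u := by
    by_contra hlt
    exact hu (htmin u (by omega))
  refine ⟨u, huN.le, t, htu.le, humin, ?_⟩
  refine (norm_norlundKernel_le_of_sum_le hq0 hq (M_pos hm (u + 1)) hD
    (norm_sum_dirichletKernel_le hm htu ht hu) n).trans ?_
  have hMu : (1 : ℝ) ≤ M m (u + 1) := by exact_mod_cast M_pos hm (u + 1)
  have hQ : sumQ q (M m (u + 1) + 1) ≤ C * ((2 * B : ℝ) ^ α * (M m u : ℝ) ^ α) := by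
    refine (hC _).trans ?_
    rw [← Real.mul_rpow (by positivity) (by positivity)]
    gcongr
    push_cast
    linarith [hM u]
  have hnM : (M m u : ℝ) ^ α ≤ (n : ℝ) ^ α * ((M m u : ℝ) / M m N) ^ α := by
    rw [← Real.mul_rpow (by positivity) (by positivity)]
    gcongr
    rw [mul_div_assoc', le_div_iff₀ hMN, mul_comm]
    gcongr
  calc 3 * (M m (t + 1) : ℝ) * sumQ q (M m (u + 1) + 1)
      ≤ 3 * (B * M m t) * (C * ((2 * B : ℝ) ^ α * ((n : ℝ) ^ α * ((M m u : ℝ) / M m N) ^ α))) := by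
        have := sumQ_nonneg hq0 (M m (u + 1) + 1)
        refine mul_le_mul (by linarith [hM t]) (hQ.trans ?_) this (by positivity)
        gcongr
    _ = _ := by ring

end Kernels

/-! ### Haar measure and cylinder sets -/

section HaarMeasure

variable {m : ℕ → ℕ}

theorem isProbabilityMeasure_haar (hm : ∀ k, 2 ≤ m k) : IsProbabilityMeasure (haar m) := by
  have := isProbabilityMeasure_factor m hm
  rw [haar]
  infer_instance

theorem measurePreserving_add_right (hm : ∀ k, 2 ≤ m k) (a : Gm m) :
    MeasurePreserving (fun x => x + a) (haar m) (haar m) := by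
  have := isProbabilityMeasure_factor m hm
  have hz : ∀ k, NeZero (m k) := fun k => ⟨by have := hm k; omega⟩
  refine ⟨measurable_pi_lambda _ fun k =>
    (Measurable.of_discrete (f := fun c : ZMod (m k) => c + a k)).comp (measurable_pi_apply k), ?_⟩
  have h := Measure.infinitePi_map_pi
    (fun k => uniformOn (Set.univ : Set (ZMod (m k)))) (f := fun k c => c + a k)
    (fun k => Measurable.of_discrete)
  refine h.trans ?_
  rw [haar]
  congr 1
  ext k s hs
  rw [Measure.map_apply Measurable.of_discrete hs, uniformOn_univ, uniformOn_univ]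
  congr 1
  rw [← Measure.count_injective_image (Equiv.addRight (a k)).injective]
  congr 1
  exact (Equiv.addRight (a k)).image_preimage s

theorem haar_preimage_add_right (hm : ∀ k, 2 ≤ m k) (a : Gm m) {E : Set (Gm m)}
    (hE : MeasurableSet E) : haar m ((fun x => x + a) ⁻¹' E) = haar m E :=
  (measurePreserving_add_right hm a).measure_preimage hE.nullMeasurableSet

theorem haar_iUnion_preimage_le (hm : ∀ k, 2 ≤ m k) {B : ℕ} (hB : ∀ k, m k ≤ B) (t : ℕ)
    {E : Set (Gm m)} (hE : MeasurableSet E) :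
    haar m (⋃ s : ZMod (m t), (fun x => x + Pi.single t s) ⁻¹' E) ≤ B * haar m E := by
  have : NeZero (m t) := ⟨by have := hm t; omega⟩
  refine (measure_iUnion_fintype_le _ _).trans ?_
  rw [Finset.sum_congr rfl fun s _ => haar_preimage_add_right hm _ hE, Finset.sum_const,
    Finset.card_univ, ZMod.card, nsmul_eq_mul]
  gcongr
  exact_mod_cast hB t

/-- The coset `I_N(x)`: the points with the same first `N` coordinates as `x`. -/
def cell (N : ℕ) (x : Gm m) : Set (Gm m) := {y | ∀ i < N, y i = x i}

/-- The points with the same first `j` coordinates as `x`, the coordinate `t` excepted. -/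
def slab (j t : ℕ) (x : Gm m) : Set (Gm m) := {y | ∀ i < j, i ≠ t → y i = x i}

theorem mem_cell_comm {N : ℕ} {x y : Gm m} : y ∈ cell N x ↔ x ∈ cell N y :=
  forall₂_congr fun _ _ => eq_comm

theorem cell_eq_cell {N : ℕ} {x y : Gm m} (h : ∀ i < N, x i = y i) : cell N x = cell N y := by
  ext z
  exact forall₂_congr fun i hi => by rw [h i hi]

theorem cell_eq_pi (N : ℕ) (x : Gm m) :
    cell N x = (Finset.range N : Set ℕ).pi fun i => {x i} := by
  ext y
  simp [cell, Set.mem_pi]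

theorem measurableSet_slab (j t : ℕ) (x : Gm m) : MeasurableSet (slab j t x) := by
  have : slab j t x = ⋂ i, ⋂ (_ : i < j), ⋂ (_ : i ≠ t), (fun y : Gm m => y i) ⁻¹' {x i} := by
    ext y
    simp [slab]
  rw [this]
  exact .iInter fun i => .iInter fun _ => .iInter fun _ => measurable_pi_apply i .of_discrete

theorem haar_cell (hm : ∀ k, 2 ≤ m k) (N : ℕ) (x : Gm m) :
    haar m (cell N x) = (M m N : ℝ≥0∞)⁻¹ := by
  have := isProbabilityMeasure_factor m hm
  have hz : ∀ k, NeZero (m k) := fun k => ⟨by have := hm k; omega⟩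
  rw [cell_eq_pi, haar, Measure.infinitePi_pi _ fun i _ => .of_discrete]
  simp only [uniformOn_univ, Measure.count_singleton, ZMod.card, M]
  push_cast
  simp only [one_div]
  exact (ENNReal.prod_inv_distrib fun i _ j _ _ => Or.inr (ENNReal.natCast_ne_top _)).symm

theorem measurableSet_setOf_cell (hm : ∀ k, 2 ≤ m k) (N : ℕ) :
    MeasurableSet {p : Gm m × Gm m | p.2 ∈ cell N p.1} := by
  have hz : ∀ k, NeZero (m k) := fun k => ⟨by have := hm k; omega⟩
  have : {p : Gm m × Gm m | p.2 ∈ cell N p.1} =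
      ⋂ i, ⋂ (_ : i < N), ⋃ c : ZMod (m i),
        (fun p : Gm m × Gm m => p.1 i) ⁻¹' {c} ∩ (fun p : Gm m × Gm m => p.2 i) ⁻¹' {c} := by
    ext p
    simp only [cell, Set.mem_ofPred_eq, Set.mem_iInter, Set.mem_iUnion, Set.mem_inter_iff,
      Set.mem_preimage, Set.mem_singleton_iff]
    exact forall₂_congr fun i _ => ⟨fun h => ⟨_, rfl, h⟩, fun ⟨c, h1, h2⟩ => h2.trans h1.symm⟩
  rw [this]
  exact .iInter fun i => .iInter fun _ => .iUnion fun c =>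
    (((measurable_pi_apply i).comp measurable_fst) .of_discrete).inter
      (((measurable_pi_apply i).comp measurable_snd) .of_discrete)

/-- The average of `h` over the coset `I_N(x)`. -/
noncomputable def average (N : ℕ) (h : Gm m → ℝ≥0∞) (x : Gm m) : ℝ≥0∞ :=
  M m N * ∫⁻ y in cell N x, h y ∂(haar m)

theorem average_congr {N : ℕ} (h : Gm m → ℝ≥0∞) {x y : Gm m} (hxy : ∀ i < N, x i = y i) :
    average N h x = average N h y := by
  rw [average, average, cell_eq_cell hxy]

/-- A set described by the first `N` coordinates is measurable. -/
theorem measurableSet_of_forall_cell (hm : ∀ k, 2 ≤ m k) {N : ℕ} {E : Set (Gm m)}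
    (hE : ∀ x y : Gm m, (∀ i < N, x i = y i) → x ∈ E → y ∈ E) : MeasurableSet E := by
  have hz : ∀ k, NeZero (m k) := fun k => ⟨by have := hm k; omega⟩
  set r : Gm m → (∀ i : Finset.range N, ZMod (m i)) := (Finset.range N).restrict with hr
  have : E = r ⁻¹' (r '' E) := by
    refine Set.Subset.antisymm (Set.subset_preimage_image _ _) ?_
    rintro y ⟨x, hx, hxy⟩
    exact hE x y (fun i hi => congrFun hxy ⟨i, Finset.mem_range.2 hi⟩) hx
  rw [this]
  exact (Finset.measurable_restrict _) (Set.toFinite _).measurableSet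

/-- Averaging over the cosets of `I_N` preserves integrals over unions of such cosets. -/
theorem setLIntegral_average (hm : ∀ k, 2 ≤ m k) {N : ℕ} {h : Gm m → ℝ≥0∞}
    (hh : AEMeasurable h (haar m)) {E : Set (Gm m)}
    (hE : ∀ x y : Gm m, (∀ i < N, x i = y i) → x ∈ E → y ∈ E) :
    ∫⁻ x in E, average N h x ∂(haar m) = ∫⁻ x in E, h x ∂(haar m) := by
  have := isProbabilityMeasure_haar hm
  have hEm := measurableSet_of_forall_cell hm hE
  have hMN : (M m N : ℝ≥0∞) ≠ 0 := by exact_mod_cast (M_pos hm N).ne'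
  -- the averages have the symmetric kernel `M_N k(x, y)`, so that Tonelli's theorem applies
  set k : Gm m → Gm m → ℝ≥0∞ := fun x y => {p : Gm m × Gm m | p.2 ∈ cell N p.1}.indicator 1 (x, y)
    with hk
  have hkm : Measurable (Function.uncurry k) := measurable_one.indicator (measurableSet_setOf_cell hm N)
  have hcm : ∀ x : Gm m, MeasurableSet (cell N x) := fun x =>
    measurableSet_of_forall_cell hm (N := N) fun y z hyz hy i hi => (hyz i hi).symm.trans (hy i hi)
  have hkx : ∀ x y, k x y * h y = (cell N x).indicator h y := by
    intro x y
    by_cases hxy : y ∈ cell N x <;> simp [hk, hxy]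
  have hky : ∀ y, ∀ x, E.indicator (fun x => k x y) x =
      E.indicator 1 y * (cell N y).indicator (1 : Gm m → ℝ≥0∞) x := by
    intro y x
    by_cases hxy : x ∈ cell N y
    · have hxE : x ∈ E ↔ y ∈ E := ⟨hE x y hxy, hE y x fun i hi => (hxy i hi).symm⟩
      by_cases hy : y ∈ E <;> simp [hk, hxE, hy, hxy, mem_cell_comm.1 hxy]
    · have : y ∉ cell N x := fun h => hxy (mem_cell_comm.1 h)
      by_cases hx : x ∈ E <;> simp [hk, hx, hxy, this]
  calc ∫⁻ x in E, average N h x ∂(haar m)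
      = M m N * ∫⁻ x in E, ∫⁻ y, k x y * h y ∂(haar m) ∂(haar m) := by
        rw [← lintegral_const_mul' _ _ (ENNReal.natCast_ne_top _)]
        refine lintegral_congr fun x => ?_
        simp only [average, hkx]
        rw [lintegral_indicator (hcm x)]
    _ = M m N * ∫⁻ y, ∫⁻ x in E, k x y * h y ∂(haar m) ∂(haar m) := by
        rw [lintegral_lintegral_swap]
        exact hkm.aemeasurable.mul (hh.comp_snd)
    _ = M m N * ∫⁻ y, (M m N : ℝ≥0∞)⁻¹ * E.indicator h y ∂(haar m) := by
        congr 1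
        refine lintegral_congr fun y => ?_
        rw [lintegral_mul_const _ (hkm.of_uncurry_right (y := y)),
          ← lintegral_indicator hEm]
        simp only [hky]
        rw [lintegral_const_mul _ (measurable_one.indicator (hcm y)),
          lintegral_indicator_one (hcm y), haar_cell hm]
        by_cases hy : y ∈ E <;> simp [hy]
    _ = ∫⁻ x in E, h x ∂(haar m) := by
        rw [lintegral_const_mul' _ _ (ENNReal.inv_ne_top.2 hMN), ← mul_assoc,
          ENNReal.mul_inv_cancel hMN (ENNReal.natCast_ne_top _), one_mul, lintegral_indicator hEm]

/-! ### A shifted maximal function -/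

/-- The set where the averages of `h` exceed `l` at level `N` for the first time. -/
def stoppingSet (h : Gm m → ℝ≥0∞) (l : ℝ≥0∞) (N : ℕ) : Set (Gm m) :=
  {x | l < average N h x ∧ ∀ i < N, average i h x ≤ l}

theorem stoppingSet_congr {h : Gm m → ℝ≥0∞} {l : ℝ≥0∞} {N : ℕ} (x y : Gm m)
    (hxy : ∀ i < N, x i = y i) (hx : x ∈ stoppingSet h l N) : y ∈ stoppingSet h l N :=
  ⟨average_congr h hxy ▸ hx.1, fun i hi =>
    average_congr h (fun j hj => hxy j (hj.trans hi)) ▸ hx.2 i hi⟩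

theorem exists_mem_stoppingSet {h : Gm m → ℝ≥0∞} {l : ℝ≥0∞} {j : ℕ} {x : Gm m}
    (hx : l < average j h x) : ∃ N ≤ j, x ∈ stoppingSet h l N := by
  classical
  have hex : ∃ N, l < average N h x := ⟨j, hx⟩
  exact ⟨Nat.find hex, Nat.find_min' hex hx, Nat.find_spec hex, fun i hi =>
    not_lt.1 (Nat.find_min hex hi)⟩

theorem tsum_haar_stoppingSet_le (hm : ∀ k, 2 ≤ m k) {h : Gm m → ℝ≥0∞}
    (hh : AEMeasurable h (haar m)) (l : ℝ≥0∞) :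
    l * ∑' N, haar m (stoppingSet h l N) ≤ ∫⁻ x, h x ∂(haar m) := by
  have hmeas : ∀ N, MeasurableSet (stoppingSet h l N) := fun N =>
    measurableSet_of_forall_cell hm stoppingSet_congr
  have hdisj : Pairwise (Function.onFun Disjoint (stoppingSet h l)) := by
    refine (pairwise_disjoint_on _).2 fun N K hNK => Set.disjoint_left.2 fun x hx hx' => ?_
    exact (hx'.2 N hNK).not_gt hx.1
  rw [← ENNReal.tsum_mul_left]
  calc ∑' N, l * haar m (stoppingSet h l N)
      ≤ ∑' N, ∫⁻ x in stoppingSet h l N, h x ∂(haar m) := by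
        refine ENNReal.tsum_le_tsum fun N => ?_
        rw [← setLIntegral_average hm hh stoppingSet_congr, ← setLIntegral_const]
        exact setLIntegral_mono' (hmeas N) fun x hx => hx.1.le
    _ = ∫⁻ x in ⋃ N, stoppingSet h l N, h x ∂(haar m) := (lintegral_iUnion hmeas hdisj h).symm
    _ ≤ ∫⁻ x, h x ∂(haar m) := setLIntegral_le_lintegral _ _

/-- A slab is covered by the cosets obtained by changing its free coordinate. -/
theorem lintegral_slab_le (hm : ∀ k, 2 ≤ m k) (h : Gm m → ℝ≥0∞) (j t : ℕ) (x : Gm m) :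
    haveI : NeZero (m t) := ⟨by have := hm t; omega⟩
    ∫⁻ y in slab j t x, h y ∂(haar m) ≤
      ∑ s : ZMod (m t), ∫⁻ y in cell j (x + Pi.single t s), h y ∂(haar m) := by
  have : NeZero (m t) := ⟨by have := hm t; omega⟩
  refine (lintegral_mono_set (fun y hy => ?_)).trans
    ((lintegral_iUnion_le (fun s => cell j (x + Pi.single t s)) h).trans (tsum_fintype _).le)
  refine Set.mem_iUnion.2 ⟨y t - x t, fun i hi => ?_⟩
  by_cases hit : i = t
  · subst hit
    simp
  · simp [Pi.single_eq_of_ne hit, hy i hi hit]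

/-- Weak type bound for the averages over slabs whose free coordinate lies `d` places before the
end. The constant grows only linearly in `d`: translating a stopping set of level `N` in the
coordinate `t` changes it only if `t < N`, which leaves `d` possible values for `t`. -/
theorem haar_slab_maximal_le (hm : ∀ k, 2 ≤ m k) {B : ℕ} (hB : ∀ k, m k ≤ B)
    {h : Gm m → ℝ≥0∞} (hh : AEMeasurable h (haar m)) (l : ℝ≥0∞) (d : ℕ) :
    l * haar m {x | ∃ j ≥ d, l * B < M m j * ∫⁻ y in slab j (j - d) x, h y ∂(haar m)} ≤
      (1 + d * B) * ∫⁻ x, h x ∂(haar m) := by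
  have hz : ∀ k, NeZero (m k) := fun k => ⟨by have := hm k; omega⟩
  have hmeas : ∀ N, MeasurableSet (stoppingSet h l N) := fun N =>
    measurableSet_of_forall_cell hm stoppingSet_congr
  have hsub : {x | ∃ j ≥ d, l * B < M m j * ∫⁻ y in slab j (j - d) x, h y ∂(haar m)} ⊆
      ⋃ N, (stoppingSet h l N ∪ ⋃ t ∈ Finset.Ico (N - d) N, ⋃ s : ZMod (m t),
        (fun x => x + Pi.single t s) ⁻¹' stoppingSet h l N) := by
    rintro x ⟨j, hjd, hx⟩
    obtain ⟨s, hs⟩ : ∃ s : ZMod (m (j - d)), l < average j h (x + Pi.single (j - d) s) := by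
      by_contra! hle
      refine hx.not_ge ?_
      calc M m j * ∫⁻ y in slab j (j - d) x, h y ∂(haar m)
          ≤ M m j * ∑ s : ZMod (m (j - d)),
            ∫⁻ y in cell j (x + Pi.single (j - d) s), h y ∂(haar m) := by
            gcongr
            exact lintegral_slab_le hm h j (j - d) x
        _ = ∑ s : ZMod (m (j - d)), average j h (x + Pi.single (j - d) s) := by
            rw [Finset.mul_sum]; rfl
        _ ≤ ∑ _s : ZMod (m (j - d)), l := Finset.sum_le_sum fun s _ => hle s
        _ = m (j - d) * l := by simp [ZMod.card]
        _ ≤ l * B := by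
            rw [mul_comm]
            gcongr
            exact_mod_cast hB _
    obtain ⟨N, hNj, hN⟩ := exists_mem_stoppingSet hs
    refine Set.mem_iUnion.2 ⟨N, ?_⟩
    -- a translation in a coordinate beyond the level of the stopping set does not leave it
    rcases lt_or_ge (j - d) N with hlt | hge
    · exact Or.inr (Set.mem_iUnion₂.2 ⟨j - d, Finset.mem_Ico.2 ⟨by omega, hlt⟩,
        Set.mem_iUnion.2 ⟨s, hN⟩⟩)
    · refine Or.inl (stoppingSet_congr _ _ (fun i hi => ?_) hN)
      simp [Pi.single_eq_of_ne (by omega : i ≠ j - d)]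
  have hN : ∀ N, haar m (stoppingSet h l N ∪ ⋃ t ∈ Finset.Ico (N - d) N, ⋃ s : ZMod (m t),
      (fun x => x + Pi.single t s) ⁻¹' stoppingSet h l N) ≤
      (1 + d * B) * haar m (stoppingSet h l N) := by
    intro N
    refine (measure_union_le _ _).trans ?_
    rw [add_mul, one_mul]
    gcongr
    refine (measure_biUnion_finset_le (Finset.Ico (N - d) N) _).trans ?_
    refine (Finset.sum_le_card_nsmul _ _ _ fun t _ =>
      haar_iUnion_preimage_le hm hB t (hmeas N)).trans ?_
    rw [nsmul_eq_mul, ← mul_assoc, Nat.card_Ico]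
    gcongr
    omega
  calc l * haar m {x | ∃ j ≥ d, l * B < M m j * ∫⁻ y in slab j (j - d) x, h y ∂(haar m)}
      ≤ l * ∑' N, (1 + d * B) * haar m (stoppingSet h l N) := by
        gcongr
        exact (measure_mono hsub).trans ((measure_iUnion_le _).trans (ENNReal.tsum_le_tsum hN))
    _ = (1 + d * B) * (l * ∑' N, haar m (stoppingSet h l N)) := by
        rw [ENNReal.tsum_mul_left]; ring
    _ ≤ (1 + d * B) * ∫⁻ x, h x ∂(haar m) := by
        gcongr
        exact tsum_haar_stoppingSet_le hm hh l

end HaarMeasure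

/-! ### The maximal inequality -/

section Maximal

variable {m : ℕ → ℕ} {q : ℕ → ℝ}

theorem measurable_psi (hm : ∀ k, 2 ≤ m k) (n : ℕ) : Measurable (psi m n) := by
  have hz : ∀ k, NeZero (m k) := fun k => ⟨by have := hm k; omega⟩
  refine Finset.measurable_prod _ fun k _ => Measurable.pow_const ?_ _
  exact (Measurable.of_discrete (f := fun c : ZMod (m k) =>
    Complex.exp (2 * Real.pi * Complex.I * (c.val : ℂ) / (m k : ℂ)))).comp (measurable_pi_apply k)

theorem integrable_mul_conj_psi (hm : ∀ k, 2 ≤ m k) {f : Gm m → ℂ}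
    (hf : Integrable f (haar m)) (n : ℕ) :
    Integrable (fun x => f x * (starRingEnd ℂ) (psi m n x)) (haar m) := by
  refine hf.mul_bdd (c := 1)
    (Complex.continuous_conj.measurable.comp (measurable_psi hm n)).aestronglyMeasurable ?_
  exact Eventually.of_forall fun x => by simp [norm_psi hm]

theorem partialSum_eq_integral (hm : ∀ k, 2 ≤ m k) {f : Gm m → ℂ}
    (hf : Integrable f (haar m)) (n : ℕ) (x : Gm m) :
    Integrable (fun y => f y * dirichletKernel m n (x - y)) (haar m) ∧
    partialSum m n f x = ∫ y, f y * dirichletKernel m n (x - y) ∂(haar m) := by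
  have h : (fun y => f y * dirichletKernel m n (x - y)) = fun y =>
      ∑ k ∈ Finset.range n, f y * (starRingEnd ℂ) (psi m k y) * psi m k x := by
    ext y
    rw [dirichletKernel, Finset.mul_sum]
    exact Finset.sum_congr rfl fun k _ => by rw [psi_sub hm]; ring
  have hi := fun k => (integrable_mul_conj_psi hm hf k).mul_const (psi m k x)
  rw [h]
  refine ⟨integrable_finsetSum _ fun k _ => hi k, ?_⟩
  rw [integral_finsetSum _ fun k _ => hi k, partialSum]
  exact Finset.sum_congr rfl fun k _ => by rw [integral_mul_const, fourierCoeff]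

/-- The unnormalized Nörlund sums `∑_{k=1}^n q_{n-k} S_k f`. -/
noncomputable def norlundSum (m : ℕ → ℕ) (q : ℕ → ℝ) (n : ℕ) (f : Gm m → ℂ) (x : Gm m) : ℂ :=
  ∑ k ∈ Finset.Icc 1 n, (q (n - k) : ℂ) * partialSum m k f x

theorem norlundSum_eq_integral (hm : ∀ k, 2 ≤ m k) {f : Gm m → ℂ}
    (hf : Integrable f (haar m)) (n : ℕ) (x : Gm m) :
    norlundSum m q n f x = ∫ y, f y * norlundKernel m q n (x - y) ∂(haar m) := by
  have h := partialSum_eq_integral hm hf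
  simp only [norlundSum, norlundKernel, Finset.mul_sum]
  rw [integral_finsetSum]
  · refine Finset.sum_congr rfl fun k _ => ?_
    rw [(h k x).2, ← integral_const_mul]
    exact integral_congr_ae (Eventually.of_forall fun y => by ring)
  · intro k _
    exact ((h k x).1.const_mul (q (n - k) : ℂ)).congr (Eventually.of_forall fun y => by ring)

theorem exists_M_le_lt (hm : ∀ k, 2 ≤ m k) {n : ℕ} (hn : 1 ≤ n) :
    ∃ N, M m N ≤ n ∧ n < M m (N + 1) := by
  have hex : ∃ k, n < M m k := ⟨n, lt_M m hm n⟩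
  obtain ⟨N, hN⟩ : ∃ N, Nat.find hex = N + 1 := by
    refine Nat.exists_eq_add_one.2 (Nat.pos_of_ne_zero fun h0 => ?_)
    have := Nat.find_spec hex
    rw [h0] at this
    simp [M] at this
    omega
  exact ⟨N, not_lt.1 (Nat.find_min hex (by omega)), hN ▸ Nat.find_spec hex⟩

theorem sum_geometric_range_le {r : ℝ} (h0 : 0 ≤ r) (h1 : r < 1) (n : ℕ) :
    ∑ i ∈ Finset.range n, r ^ i ≤ (1 - r)⁻¹ := by
  rw [← tsum_geometric_of_lt_one h0 h1]
  exact (summable_geometric_of_lt_one h0 h1).sum_le_tsum _ fun i _ => by positivity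

theorem sum_sum_geometric_le {a b : ℝ} (ha0 : 0 ≤ a) (ha1 : a < 1) (hb0 : 0 ≤ b) (hb1 : b < 1)
    (N : ℕ) : ∑ j ∈ Finset.range (N + 1), ∑ t ∈ Finset.range (j + 1), a ^ (N - j) * b ^ (j - t) ≤
      (1 - a)⁻¹ * (1 - b)⁻¹ := by
  have h : ∀ (r : ℝ) (j : ℕ), ∑ t ∈ Finset.range (j + 1), r ^ (j - t) =
      ∑ t ∈ Finset.range (j + 1), r ^ t := fun r j => by
    rw [← Finset.sum_range_reflect]
    refine Finset.sum_congr rfl fun t ht => ?_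
    congr 1
    have := Finset.mem_range.1 ht
    omega
  have ha' : 0 ≤ (1 - a)⁻¹ := inv_nonneg.2 (by linarith)
  have hb' : 0 ≤ (1 - b)⁻¹ := inv_nonneg.2 (by linarith)
  calc _ = ∑ j ∈ Finset.range (N + 1), a ^ (N - j) * ∑ t ∈ Finset.range (j + 1), b ^ t := by
        simp only [← h b, Finset.mul_sum]
    _ ≤ ∑ j ∈ Finset.range (N + 1), a ^ (N - j) * (1 - b)⁻¹ := by
        gcongr
        exact sum_geometric_range_le hb0 hb1 _
    _ = (∑ j ∈ Finset.range (N + 1), a ^ j) * (1 - b)⁻¹ := by rw [← Finset.sum_mul, h a]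
    _ ≤ _ := by
        gcongr
        exact sum_geometric_range_le ha0 ha1 _

/-- Pointwise domination of the Nörlund sums by averages over slabs: the slabs of depth `d = j - t`
enter with the weight `2⁻ᵈ`, so that averages growing like `(3/2)^d` are harmless. -/
theorem enorm_norlundSum_le (hm : ∀ k, 2 ≤ m k) {B : ℕ} (hB : ∀ k, m k ≤ B)
    (hq0 : ∀ k, 0 ≤ q k) (hq : ∀ i j, 1 ≤ i → i ≤ j → q j ≤ q i) {α C : ℝ} (hα : 0 < α)
    (hC : ∀ n : ℕ, sumQ q n ≤ C * (n : ℝ) ^ α) {f : Gm m → ℂ}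
    (hf : Integrable f (haar m)) {l : ℝ} (hl : 0 ≤ l) {x : Gm m}
    (hx : ∀ d, ∀ j ≥ d, M m j * ∫⁻ y in slab j (j - d) x, ‖f y‖ₑ ∂(haar m) ≤
      ENNReal.ofReal (l * (3 / 2) ^ d)) {n : ℕ} (hn : 1 ≤ n) :
    ‖norlundSum m q n f x‖ₑ ≤ ENNReal.ofReal
      (3 * B * C * (2 * B : ℝ) ^ α * (4 * (1 - 2⁻¹ ^ α)⁻¹) * l * (n : ℝ) ^ α) := by
  obtain ⟨N, hN, hnN⟩ := exists_M_le_lt hm hn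
  have hC0 : 0 ≤ C := by
    have := (sumQ_nonneg hq0 1).trans (hC 1)
    simpa using this
  have hMpos : ∀ k, (0 : ℝ) < M m k := fun k => by exact_mod_cast M_pos hm k
  have hratio : ∀ i d, (M m i : ℝ) / M m (i + d) ≤ 2⁻¹ ^ d := fun i d => by
    rw [div_le_iff₀ (hMpos _), inv_pow, inv_mul_eq_div, le_div_iff₀ (by positivity), mul_comm]
    exact_mod_cast two_pow_mul_M_le hm i d
  set A : ℝ := 3 * B * C * (2 * B : ℝ) ^ α * (n : ℝ) ^ α with hA
  have hA0 : 0 ≤ A := by positivity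
  set c : ℕ → ℕ → ℝ := fun j t => A * ((M m j : ℝ) / M m N) ^ α * M m t with hc
  have hker : ∀ y, ‖f y * norlundKernel m q n (x - y)‖ₑ ≤
      ∑ j ∈ Finset.range (N + 1), ∑ t ∈ Finset.range (j + 1),
        ENNReal.ofReal (c j t) * (slab j t x).indicator (fun y => ‖f y‖ₑ) y := by
    intro y
    obtain ⟨j, hj, t, ht, hz, hle⟩ :=
      exists_norm_norlundKernel_le hm hB hq0 hq hα hC hN hnN.le (x - y)
    have hy : y ∈ slab j t x := fun i hi hit => (sub_eq_zero.1 (hz i hi hit)).symm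
    have h1 : ‖norlundKernel m q n (x - y)‖ₑ ≤ ENNReal.ofReal (c j t) := by
      rw [← ofReal_norm]
      exact ENNReal.ofReal_le_ofReal hle
    calc ‖f y * norlundKernel m q n (x - y)‖ₑ
        ≤ ENNReal.ofReal (c j t) * (slab j t x).indicator (fun y => ‖f y‖ₑ) y := by
          rw [enorm_mul, Set.indicator_of_mem hy, mul_comm]
          gcongr
      _ ≤ ∑ t ∈ Finset.range (j + 1),
            ENNReal.ofReal (c j t) * (slab j t x).indicator (fun y => ‖f y‖ₑ) y :=
          Finset.single_le_sum (f := fun t =>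
            ENNReal.ofReal (c j t) * (slab j t x).indicator (fun y => ‖f y‖ₑ) y)
            (fun _ _ => zero_le) (Finset.mem_range.2 (by omega))
      _ ≤ _ := Finset.single_le_sum (f := fun j => ∑ t ∈ Finset.range (j + 1),
            ENNReal.ofReal (c j t) * (slab j t x).indicator (fun y => ‖f y‖ₑ) y)
            (fun _ _ => zero_le) (Finset.mem_range.2 (by omega))
  have hmeas : ∀ j t, AEMeasurable
      (fun y => ENNReal.ofReal (c j t) * (slab j t x).indicator (fun y => ‖f y‖ₑ) y)
      (haar m) := fun j t =>
    ((hf.aestronglyMeasurable.enorm).indicator (measurableSet_slab j t x)).const_mul _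
  have hterm : ∀ j ≤ N, ∀ t ≤ j, ENNReal.ofReal (c j t) *
      ∫⁻ y in slab j t x, ‖f y‖ₑ ∂(haar m) ≤
        ENNReal.ofReal (A * l * ((2⁻¹ ^ α) ^ (N - j) * (3 / 4) ^ (j - t))) := by
    intro j hj t ht
    have h1 := hx (j - t) j (Nat.sub_le _ _)
    rw [Nat.sub_sub_self ht] at h1
    have h2 : ENNReal.ofReal (c j t) = ENNReal.ofReal (c j t / M m j) * M m j := by
      rw [← ENNReal.ofReal_natCast, ← ENNReal.ofReal_mul (by positivity),
        div_mul_cancel₀ _ (hMpos j).ne']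
    have h3 : c j t / M m j * (l * (3 / 2) ^ (j - t)) ≤
        A * l * ((2⁻¹ ^ α) ^ (N - j) * (3 / 4) ^ (j - t)) := by
      have e1 := hratio j (N - j)
      have e2 := hratio t (j - t)
      rw [Nat.add_sub_cancel' hj] at e1
      rw [Nat.add_sub_cancel' ht] at e2
      have e3 : ((M m j : ℝ) / M m N) ^ α ≤ (2⁻¹ ^ α) ^ (N - j) := by
        rw [← Real.rpow_natCast, ← Real.rpow_mul (by norm_num), mul_comm α, Real.rpow_mul
          (by norm_num), Real.rpow_natCast]
        exact Real.rpow_le_rpow (by positivity) e1 hα.le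
      calc c j t / M m j * (l * (3 / 2) ^ (j - t))
          = A * l * (((M m j : ℝ) / M m N) ^ α * ((M m t / M m j) * (3 / 2) ^ (j - t))) := by
            rw [hc]; ring
        _ ≤ A * l * ((2⁻¹ ^ α) ^ (N - j) * (2⁻¹ ^ (j - t) * (3 / 2) ^ (j - t))) := by gcongr
        _ = _ := by rw [← mul_pow]; norm_num
    rw [h2, mul_assoc]
    calc ENNReal.ofReal (c j t / M m j) * (M m j * ∫⁻ y in slab j t x, ‖f y‖ₑ ∂(haar m))
        ≤ ENNReal.ofReal (c j t / M m j) * ENNReal.ofReal (l * (3 / 2) ^ (j - t)) := by gcongr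
      _ = ENNReal.ofReal (c j t / M m j * (l * (3 / 2) ^ (j - t))) :=
          (ENNReal.ofReal_mul (by positivity)).symm
      _ ≤ _ := ENNReal.ofReal_le_ofReal h3
  have hhalf : (2⁻¹ : ℝ) ^ α < 1 := Real.rpow_lt_one (by norm_num) (by norm_num) hα
  calc ‖norlundSum m q n f x‖ₑ
      ≤ ∫⁻ y, ‖f y * norlundKernel m q n (x - y)‖ₑ ∂(haar m) := by
        rw [norlundSum_eq_integral hm hf]
        exact enorm_integral_le_lintegral_enorm _
    _ ≤ ∫⁻ y, ∑ j ∈ Finset.range (N + 1), ∑ t ∈ Finset.range (j + 1),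
        ENNReal.ofReal (c j t) * (slab j t x).indicator (fun y => ‖f y‖ₑ) y ∂(haar m) :=
        lintegral_mono hker
    _ = ∑ j ∈ Finset.range (N + 1), ∑ t ∈ Finset.range (j + 1),
        ENNReal.ofReal (c j t) * ∫⁻ y in slab j t x, ‖f y‖ₑ ∂(haar m) := by
        rw [lintegral_finsetSum' _ fun j _ => Finset.aemeasurable_fun_sum _ fun t _ => hmeas j t]
        refine Finset.sum_congr rfl fun j _ => ?_
        rw [lintegral_finsetSum' _ fun t _ => hmeas j t]
        refine Finset.sum_congr rfl fun t _ => ?_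
        rw [lintegral_const_mul' _ _ ENNReal.ofReal_ne_top,
          lintegral_indicator (measurableSet_slab j t x)]
    _ ≤ ∑ j ∈ Finset.range (N + 1), ∑ t ∈ Finset.range (j + 1),
        ENNReal.ofReal (A * l * ((2⁻¹ ^ α) ^ (N - j) * (3 / 4) ^ (j - t))) := by
        refine Finset.sum_le_sum fun j hj => Finset.sum_le_sum fun t ht => ?_
        simp only [Finset.mem_range] at hj ht
        exact hterm j (by omega) t (by omega)
    _ = ENNReal.ofReal (A * l * ∑ j ∈ Finset.range (N + 1), ∑ t ∈ Finset.range (j + 1),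
        ((2⁻¹ ^ α) ^ (N - j) * (3 / 4) ^ (j - t))) := by
        simp only [Finset.mul_sum]
        rw [ENNReal.ofReal_sum_of_nonneg fun j _ => Finset.sum_nonneg fun t _ => by positivity]
        refine Finset.sum_congr rfl fun j _ => ?_
        rw [ENNReal.ofReal_sum_of_nonneg fun t _ => by positivity]
    _ ≤ _ := by
        refine ENNReal.ofReal_le_ofReal ?_
        have := sum_sum_geometric_le (a := 2⁻¹ ^ α) (b := 3 / 4) (by positivity) hhalf
          (by norm_num) (by norm_num) N
        calc _ ≤ A * l * ((1 - 2⁻¹ ^ α)⁻¹ * (1 - 3 / 4)⁻¹) := by gcongr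
          _ = _ := by rw [hA]; norm_num; ring

/-- Weak type `(1, 1)` of the maximal operator `sup_n |∑_{k=1}^n q_{n-k} S_k f| / n^α`. -/
theorem exists_haar_norlundSum_maximal_le (hm : ∀ k, 2 ≤ m k) (hbdd : BddAbove (Set.range m))
    (hq0 : ∀ k, 0 ≤ q k) (hq : ∀ i j, 1 ≤ i → i ≤ j → q j ≤ q i) {α C : ℝ} (hα : 0 < α)
    (hC : ∀ n : ℕ, sumQ q n ≤ C * (n : ℝ) ^ α) :
    ∃ K : ℝ, ∀ f : Gm m → ℂ, Integrable f (haar m) → ∀ l : ℝ, 0 < l →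
      haar m {x | ∃ n : ℕ, 1 ≤ n ∧ l * (n : ℝ) ^ α < ‖norlundSum m q n f x‖} ≤
        ENNReal.ofReal (K / l) * ∫⁻ x, ‖f x‖ₑ ∂(haar m) := by
  obtain ⟨B, hB⟩ := hbdd
  replace hB : ∀ k, m k ≤ B := fun k => hB ⟨k, rfl⟩
  have hB0 : (0 : ℝ) < B := by exact_mod_cast (zero_lt_two.trans_le ((hm 0).trans (hB 0)))
  have hC0 : 0 ≤ C := by
    have := (sumQ_nonneg hq0 1).trans (hC 1)
    simpa using this
  have hhalf : (2⁻¹ : ℝ) ^ α < 1 := Real.rpow_lt_one (by norm_num) (by norm_num) hα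
  set K₀ : ℝ := 3 * B * C * (2 * B : ℝ) ^ α * (4 * (1 - 2⁻¹ ^ α)⁻¹) + 1 with hK₀
  have hinv : 0 < (1 - (2⁻¹ : ℝ) ^ α)⁻¹ := inv_pos.2 (by linarith)
  have hK₀pos : 0 < K₀ := by positivity
  have hsum : Summable fun d : ℕ => (1 + d * B : ℝ) * (2 / 3) ^ d := by
    have h1 : Summable fun d : ℕ => ((2 : ℝ) / 3) ^ d :=
      summable_geometric_of_lt_one (by norm_num) (by norm_num)
    have h2 : Summable fun d : ℕ => (d : ℝ) ^ 1 * ((2 : ℝ) / 3) ^ d :=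
      summable_pow_mul_geometric_of_norm_lt_one 1 (by norm_num)
    refine (h1.add (h2.mul_left (B : ℝ))).congr fun d => ?_
    ring
  set T := ∑' d : ℕ, (1 + d * B : ℝ) * (2 / 3) ^ d with hT
  refine ⟨K₀ * B * T, fun f hf l hl => ?_⟩
  set l' : ℝ := l / (K₀ * B) with hl'
  have hl'0 : 0 < l' := by positivity
  -- the thresholds grow like `(3/2)^d`, which leaves both `∑ (3/4)^d` and `∑ (1 + dB) (2/3)^d` finite
  set lam : ℕ → ℝ≥0∞ := fun d => ENNReal.ofReal (l' * (3 / 2) ^ d) with hlam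
  have hsub : {x | ∃ n : ℕ, 1 ≤ n ∧ l * (n : ℝ) ^ α < ‖norlundSum m q n f x‖} ⊆
      ⋃ d, {x | ∃ j ≥ d, lam d * B < M m j * ∫⁻ y in slab j (j - d) x, ‖f y‖ₑ ∂(haar m)} := by
    rintro x ⟨n, hn, hx⟩
    by_contra hcon
    simp only [Set.mem_iUnion, Set.mem_ofPred_eq, not_exists, not_and, not_lt] at hcon
    have h1 := enorm_norlundSum_le hm hB hq0 hq hα hC hf (l := l' * B) (by positivity) (x := x)
      (fun d j hj => (hcon d j hj).trans_eq ?_) hn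
    · rw [← ofReal_norm, ENNReal.ofReal_le_ofReal_iff (by positivity)] at h1
      refine hx.not_ge (h1.trans ?_)
      have h2 : K₀ * (l' * B) = l := by rw [hl']; field_simp
      rw [← h2]
      gcongr
      linarith
    · rw [hlam, ← ENNReal.ofReal_natCast, ← ENNReal.ofReal_mul (by positivity)]
      congr 1
      ring
  have hd : ∀ d, haar m {x | ∃ j ≥ d, lam d * B < M m j *
      ∫⁻ y in slab j (j - d) x, ‖f y‖ₑ ∂(haar m)} ≤
      ENNReal.ofReal (l'⁻¹ * ((1 + d * B) * (2 / 3) ^ d)) * ∫⁻ x, ‖f x‖ₑ ∂(haar m) := by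
    intro d
    have h1 := haar_slab_maximal_le hm hB hf.aestronglyMeasurable.enorm (lam d) d
    have hpos : 0 < l' * (3 / 2) ^ d := by positivity
    have h2 : ENNReal.ofReal (l' * (3 / 2) ^ d)⁻¹ * lam d = 1 := by
      rw [hlam, ← ENNReal.ofReal_mul (by positivity), inv_mul_cancel₀ hpos.ne', ENNReal.ofReal_one]
    calc _ = ENNReal.ofReal (l' * (3 / 2) ^ d)⁻¹ * (lam d * haar m {x | ∃ j ≥ d, lam d * B <
            M m j * ∫⁻ y in slab j (j - d) x, ‖f y‖ₑ ∂(haar m)}) := by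
          rw [← mul_assoc, h2, one_mul]
      _ ≤ ENNReal.ofReal (l' * (3 / 2) ^ d)⁻¹ *
            ((1 + d * B) * ∫⁻ x, ‖f x‖ₑ ∂(haar m)) := by gcongr
      _ = _ := by
          rw [← mul_assoc]
          congr 1
          have h3 : (1 + d * B : ℝ≥0∞) = ENNReal.ofReal (1 + d * B) := by
            rw [ENNReal.ofReal_add (by norm_num) (by positivity), ENNReal.ofReal_one,
              ENNReal.ofReal_mul (by positivity), ENNReal.ofReal_natCast, ENNReal.ofReal_natCast]
          rw [h3, ← ENNReal.ofReal_mul (by positivity)]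
          congr 1
          rw [mul_inv, ← inv_pow]
          norm_num
          ring
  calc _ ≤ ∑' d : ℕ, ENNReal.ofReal (l'⁻¹ * ((1 + d * B) * (2 / 3) ^ d)) *
        ∫⁻ x, ‖f x‖ₑ ∂(haar m) :=
        (measure_mono hsub).trans ((measure_iUnion_le _).trans (ENNReal.tsum_le_tsum hd))
    _ = _ := by
        rw [ENNReal.tsum_mul_right, ← ENNReal.ofReal_tsum_of_nonneg (fun d => by positivity)
          (hsum.mul_left _), tsum_mul_left]
        congr 2
        rw [hl', ← hT]
        field_simp

end Maximal

/-! ### Functions of finitely many coordinates -/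

section Polynomials

variable {m : ℕ → ℕ} {q : ℕ → ℝ}

theorem exists_digit_ne_zero (hm : ∀ k, 2 ≤ m k) {n N : ℕ} (hn : M m N ≤ n) :
    ∃ i ≥ N, digit m n i ≠ 0 := by
  obtain ⟨i, hi, hi'⟩ := exists_M_le_lt hm ((M_pos hm N).trans_le hn)
  refine ⟨i, ?_, ?_⟩
  · by_contra hlt
    have := M_mono hm (show i + 1 ≤ N by omega)
    omega
  · have h1 : n / M m i < m i := by
      rw [Nat.div_lt_iff_lt_mul (M_pos hm i), mul_comm, ← M_succ]
      exact hi'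
    rw [digit, Nat.mod_eq_of_lt h1]
    exact (Nat.div_pos hi (M_pos hm i)).ne'

theorem psi_single_ne_one (hm : ∀ k, 2 ≤ m k) {n i : ℕ} (hi : digit m n i ≠ 0) :
    psi m n (Pi.single i 1) ≠ 1 := by
  have hz : NeZero (m i) := ⟨by have := hm i; omega⟩
  have h1 : psi m n (Pi.single i 1) = rademacher m i (Pi.single i 1) ^ digit m n i := by
    rw [psi_eq_prod hm (le_max_left _ (i + 1)), Finset.prod_eq_single i]
    · intro k _ hk
      rw [(rademacher_eq_one_iff hm k _).2 (Pi.single_eq_of_ne hk _), one_pow]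
    · simp
  rw [h1, rademacher_eq hm, Pi.single_eq_same, ← Circle.coe_pow, ← AddChar.map_nsmul_eq_pow,
    ne_eq, Circle.coe_eq_one, ← AddChar.map_zero_eq_one (ZMod.toCircle (N := m i)),
    ZMod.injective_toCircle.eq_iff, nsmul_one, ZMod.natCast_eq_zero_iff]
  exact fun h => hi (Nat.eq_zero_of_dvd_of_lt h (Nat.mod_lt _ (NeZero.pos _)))

/-- Translation in a coordinate `i ≥ N` with nonzero digit leaves `g` fixed and multiplies `ψ_n` by a
constant other than `1`. -/
theorem fourierCoeff_eq_zero (hm : ∀ k, 2 ≤ m k) {g : Gm m → ℂ} (hg : Integrable g (haar m))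
    {N : ℕ} (hgN : ∀ x y : Gm m, (∀ i < N, x i = y i) → g x = g y) {n : ℕ} (hn : M m N ≤ n) :
    fourierCoeff m g n = 0 := by
  obtain ⟨i, hi, hd⟩ := exists_digit_ne_zero hm hn
  have hmp := measurePreserving_add_right hm (Pi.single i (1 : ZMod (m i)))
  have h1 : fourierCoeff m g n =
      fourierCoeff m g n * (starRingEnd ℂ) (psi m n (Pi.single i 1)) := by
    have hmeas := (integrable_mul_conj_psi hm hg n).aestronglyMeasurable
    rw [← hmp.map_eq] at hmeas
    conv_lhs => rw [fourierCoeff, ← hmp.map_eq, integral_map hmp.measurable.aemeasurable hmeas]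
    rw [fourierCoeff, ← integral_mul_const]
    refine integral_congr_ae (Eventually.of_forall fun y => ?_)
    have : g (y + Pi.single i 1) = g y := hgN _ _ fun k hk => by
      simp [Pi.single_eq_of_ne (show k ≠ i by omega)]
    simp only [this, psi_add hm, map_mul, mul_assoc]
  have h2 : (starRingEnd ℂ) (psi m n (Pi.single i 1)) ≠ 1 := fun h =>
    psi_single_ne_one hm hd (by simpa using congrArg (starRingEnd ℂ) h)
  by_contra h0
  exact h2 (mul_left_cancel₀ h0 (by rw [← h1, mul_one]))

theorem partialSum_M_eq (hm : ∀ k, 2 ≤ m k) {g : Gm m → ℂ} (hg : Integrable g (haar m))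
    {N : ℕ} (hgN : ∀ x y : Gm m, (∀ i < N, x i = y i) → g x = g y) (x : Gm m) :
    partialSum m (M m N) g x = g x := by
  have hcm : MeasurableSet (cell N x) := measurableSet_of_forall_cell hm (N := N)
    fun y z hyz hy i hi => (hyz i hi).symm.trans (hy i hi)
  have hM : (M m N : ℂ) ≠ 0 := by exact_mod_cast (M_pos hm N).ne'
  have h : ∀ y, g y * dirichletKernel m (M m N) (x - y) =
      (cell N x).indicator (fun _ => g x * M m N) y := by
    intro y
    by_cases hy : y ∈ cell N x
    · rw [Set.indicator_of_mem hy, dirichletKernel_M_eq hm, hgN y x hy]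
      exact fun i hi => sub_eq_zero.2 (hy i hi).symm
    · rw [Set.indicator_of_notMem hy]
      simp only [cell, Set.mem_ofPred_eq, not_forall] at hy
      obtain ⟨i, hi, hne⟩ := hy
      rw [dirichletKernel_M_eq_zero hm hi, mul_zero]
      exact fun h0 => hne (sub_eq_zero.1 h0).symm
  rw [(partialSum_eq_integral hm hg _ x).2, integral_congr_ae (Eventually.of_forall h),
    integral_indicator_const _ hcm, measureReal_def, haar_cell hm]
  simp [mul_comm (g x), hM]

theorem partialSum_eq (hm : ∀ k, 2 ≤ m k) {g : Gm m → ℂ} (hg : Integrable g (haar m))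
    {N : ℕ} (hgN : ∀ x y : Gm m, (∀ i < N, x i = y i) → g x = g y) {n : ℕ} (hn : M m N ≤ n)
    (x : Gm m) : partialSum m n g x = g x := by
  rw [← partialSum_M_eq hm hg hgN x, partialSum, ← Finset.sum_range_add_sum_Ico _ hn, partialSum,
    Finset.sum_eq_zero (s := Finset.Ico _ _), add_zero]
  intro k hk
  rw [fourierCoeff_eq_zero hm hg hgN (Finset.mem_Ico.1 hk).1, zero_mul]

theorem iSup_piLE {X : ℕ → Type*} [∀ i, MeasurableSpace (X i)] :
    ⨆ n, (Filtration.piLE (X := X) n) = MeasurableSpace.pi := by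
  refine le_antisymm (iSup_le fun n => Filtration.piLE.le n) (iSup_le fun n => ?_)
  refine le_trans ?_ (le_iSup _ n)
  exact ((measurable_pi_apply (⟨n, Set.mem_Iic.2 le_rfl⟩ : Set.Iic n)).comp
    (comap_measurable (Preorder.restrictLe n))).comap_le

/-- Lévy's upward theorem provides approximations by functions of finitely many coordinates. -/
theorem exists_real_approx (hm : ∀ k, 2 ≤ m k) {u : Gm m → ℝ} (hu : Integrable u (haar m))
    {ε : ℝ≥0∞} (hε : 0 < ε) :
    ∃ N, ∀ n ≥ N, ∃ v : Gm m → ℝ, Integrable v (haar m) ∧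
      (∀ x y : Gm m, (∀ i < n, x i = y i) → v x = v y) ∧
      ∫⁻ x, ‖u x - v x‖ₑ ∂(haar m) < ε := by
  have := isProbabilityMeasure_haar hm
  set u' := hu.aestronglyMeasurable.mk u with hu'
  have huu' : u =ᵐ[haar m] u' := hu.aestronglyMeasurable.ae_eq_mk
  have hmeas : StronglyMeasurable[⨆ n, (Filtration.piLE (X := fun k => ZMod (m k)) n)] u' := by
    rw [iSup_piLE]
    exact hu.aestronglyMeasurable.stronglyMeasurable_mk
  have hlim := (hu.congr huu').tendsto_eLpNorm_condExp hmeas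
  obtain ⟨N, hN⟩ := eventually_atTop.1 (hlim.eventually_lt_const hε)
  refine ⟨N + 1, fun n hn => ?_⟩
  obtain ⟨n, rfl⟩ : ∃ k, n = k + 1 := ⟨n - 1, by omega⟩
  refine ⟨(haar m)[u' | Filtration.piLE n], integrable_condExp, fun x y hxy => ?_, ?_⟩
  · exact stronglyMeasurable_condExp.dependsOn_of_piLE fun i hi => hxy i (Nat.lt_succ_of_le hi)
  · refine lt_of_eq_of_lt ?_ (hN n (by omega))
    rw [eLpNorm_one_eq_lintegral_enorm]
    refine lintegral_congr_ae ?_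
    filter_upwards [huu'] with x hx
    rw [hx, Pi.sub_apply, ← enorm_neg, neg_sub]

theorem exists_approx (hm : ∀ k, 2 ≤ m k) {f : Gm m → ℂ} (hf : Integrable f (haar m))
    {ε : ℝ≥0∞} (hε : 0 < ε) :
    ∃ (N : ℕ) (g : Gm m → ℂ), Integrable g (haar m) ∧
      (∀ x y : Gm m, (∀ i < N, x i = y i) → g x = g y) ∧
      ∫⁻ x, ‖f x - g x‖ₑ ∂(haar m) ≤ ε := by
  obtain ⟨N₁, h1⟩ := exists_real_approx hm hf.re (ENNReal.half_pos hε.ne')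
  obtain ⟨N₂, h2⟩ := exists_real_approx hm hf.im (ENNReal.half_pos hε.ne')
  obtain ⟨v, hv, hvd, hvε⟩ := h1 (max N₁ N₂) (le_max_left _ _)
  obtain ⟨w, hw, hwd, hwε⟩ := h2 (max N₁ N₂) (le_max_right _ _)
  refine ⟨max N₁ N₂, fun x => v x + w x * Complex.I, hv.ofReal.add (hw.ofReal.mul_const _),
    fun x y hxy => by simp only [hvd x y hxy, hwd x y hxy], ?_⟩
  have hle : ∀ x, ‖f x - (v x + w x * Complex.I)‖ₑ ≤
      ‖(f x).re - v x‖ₑ + ‖(f x).im - w x‖ₑ := by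
    intro x
    have : f x - (v x + w x * Complex.I) =
        (((f x).re - v x : ℝ) : ℂ) + (((f x).im - w x : ℝ) : ℂ) * Complex.I := by
      apply Complex.ext <;> simp
    rw [this]
    refine (enorm_add_le _ _).trans (add_le_add (le_of_eq ?_) (le_of_eq ?_))
    · rw [← ofReal_norm, ← ofReal_norm, Complex.norm_real]
    · rw [← ofReal_norm, ← ofReal_norm, norm_mul, Complex.norm_I, mul_one, Complex.norm_real]
  calc _ ≤ ∫⁻ x, ‖(f x).re - v x‖ₑ + ‖(f x).im - w x‖ₑ ∂(haar m) := lintegral_mono hle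
    _ = ∫⁻ x, ‖(f x).re - v x‖ₑ ∂(haar m) + ∫⁻ x, ‖(f x).im - w x‖ₑ ∂(haar m) :=
        lintegral_add_left' (hf.re.sub hv).aestronglyMeasurable.enorm _
    _ ≤ ε / 2 + ε / 2 := add_le_add hvε.le hwε.le
    _ = ε := ENNReal.add_halves ε

end Polynomials

/-! ### Almost everywhere convergence -/

section Convergence

variable {m : ℕ → ℕ} {q : ℕ → ℝ}

/-- Toeplitz's theorem for nonnegative triangular arrays of weights. -/
theorem tendsto_sum_mul_of_tendsto {w : ℕ → ℕ → ℝ} (hw0 : ∀ n, ∀ k ∈ Finset.Icc 1 n, 0 ≤ w n k)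
    {s : ℝ} (hs : Tendsto (fun n => ∑ k ∈ Finset.Icc 1 n, w n k) atTop (𝓝 s))
    (hw : ∀ k, 1 ≤ k → Tendsto (fun n => w n k) atTop (𝓝 0)) {a : ℕ → ℂ} {L : ℂ}
    (ha : Tendsto a atTop (𝓝 L)) :
    Tendsto (fun n => ∑ k ∈ Finset.Icc 1 n, (w n k : ℂ) * a k) atTop (𝓝 (s * L)) := by
  suffices h : Tendsto (fun n => ∑ k ∈ Finset.Icc 1 n, (w n k : ℂ) * (a k - L)) atTop (𝓝 0) by
    have h2 := h.add (((Complex.continuous_ofReal.tendsto s).comp hs).mul_const L)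
    rw [zero_add] at h2
    refine h2.congr fun n => ?_
    simp only [Function.comp_apply, Complex.ofReal_sum, Finset.sum_mul, ← Finset.sum_add_distrib]
    exact Finset.sum_congr rfl fun k _ => by ring
  rw [Metric.tendsto_atTop]
  intro ε hε
  have hs1 : 0 < |s| + 1 := by positivity
  obtain ⟨K, hK⟩ := Metric.tendsto_atTop.1 ha (ε / 2 / (|s| + 1)) (by positivity)
  have h1 : Tendsto (fun n => ∑ k ∈ Finset.Ico 1 K, |w n k| * ‖a k - L‖) atTop (𝓝 0) := by
    rw [← Finset.sum_const_zero (s := Finset.Ico 1 K)]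
    refine tendsto_finsetSum _ fun k hk => ?_
    simpa using (hw k (Finset.mem_Ico.1 hk).1).abs.mul_const ‖a k - L‖
  have hev := (h1.eventually_lt_const (half_pos hε)).and
    (hs.eventually_lt_const (show s < |s| + 1 by linarith [le_abs_self s]))
  obtain ⟨n₀, hn₀⟩ := eventually_atTop.1 hev
  refine ⟨n₀, fun n hn => ?_⟩
  obtain ⟨e1, e2⟩ := hn₀ n hn
  rw [dist_zero_right]
  have hterm : ∀ k ∈ Finset.Icc 1 n, ‖(w n k : ℂ) * (a k - L)‖ ≤
      (if k < K then |w n k| * ‖a k - L‖ else 0) + ε / 2 / (|s| + 1) * w n k := by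
    intro k hk
    have h0 := hw0 n k hk
    rw [norm_mul, Complex.norm_real, Real.norm_eq_abs]
    split_ifs with hkK
    · have : 0 ≤ ε / 2 / (|s| + 1) * w n k := by positivity
      linarith
    · have := (hK k (not_lt.1 hkK)).le
      rw [dist_eq_norm] at this
      rw [zero_add, abs_of_nonneg h0, mul_comm]
      gcongr
  calc _ ≤ ∑ k ∈ Finset.Icc 1 n,
        ((if k < K then |w n k| * ‖a k - L‖ else 0) + ε / 2 / (|s| + 1) * w n k) :=
        norm_sum_le_of_le _ hterm
    _ = ∑ k ∈ Finset.Icc 1 n with k < K, |w n k| * ‖a k - L‖ +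
        ε / 2 / (|s| + 1) * ∑ k ∈ Finset.Icc 1 n, w n k := by
        rw [Finset.sum_add_distrib, Finset.sum_filter, Finset.mul_sum]
    _ ≤ ∑ k ∈ Finset.Ico 1 K, |w n k| * ‖a k - L‖ + ε / 2 / (|s| + 1) * (|s| + 1) := by
        gcongr
        · exact fun k hk => by
            simp only [Finset.mem_filter, Finset.mem_Icc, Finset.mem_Ico] at hk ⊢
            omega
    _ < ε := by
        rw [div_mul_cancel₀ _ hs1.ne']
        linarith

theorem norlundSum_sub (hm : ∀ k, 2 ≤ m k) {f g : Gm m → ℂ} (hf : Integrable f (haar m))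
    (hg : Integrable g (haar m)) (n : ℕ) (x : Gm m) :
    norlundSum m q n (fun y => f y - g y) x = norlundSum m q n f x - norlundSum m q n g x := by
  have h : ∀ k, fourierCoeff m (fun y => f y - g y) k = fourierCoeff m f k - fourierCoeff m g k :=
    fun k => by
      simp only [fourierCoeff, sub_mul]
      exact integral_sub (integrable_mul_conj_psi hm hf k) (integrable_mul_conj_psi hm hg k)
  simp only [norlundSum, partialSum, h, sub_mul, Finset.sum_sub_distrib, mul_sub]

/-- Almost everywhere convergence of Nörlund sums with nonincreasing weights of regular growth; the
weight `q_0` is left arbitrary. -/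
theorem ae_tendsto_norlundSum (hm : ∀ k, 2 ≤ m k) (hbdd : BddAbove (Set.range m))
    (hq0 : ∀ k, 0 ≤ q k) (hq : ∀ i j, 1 ≤ i → i ≤ j → q j ≤ q i) {α c : ℝ} (hα : 0 < α)
    (hc : Tendsto (fun n : ℕ => sumQ q n / (n : ℝ) ^ α) atTop (𝓝 c)) {f : Gm m → ℂ}
    (hf : Integrable f (haar m)) :
    ∀ᵐ x ∂(haar m), Tendsto (fun n : ℕ => norlundSum m q n f x / ((n : ℝ) ^ α : ℝ)) atTop
      (𝓝 (c * f x)) := by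
  have hc0 : 0 ≤ c := ge_of_tendsto' hc fun n => div_nonneg (sumQ_nonneg hq0 n) (by positivity)
  obtain ⟨C, hC⟩ := hc.bddAbove_range
  replace hC : ∀ n : ℕ, sumQ q n ≤ C * (n : ℝ) ^ α := fun n => by
    rcases Nat.eq_zero_or_pos n with rfl | hn
    · simp [sumQ, Real.zero_rpow hα.ne']
    · exact (div_le_iff₀ (by positivity)).1 (hC ⟨n, rfl⟩)
  obtain ⟨K, hK⟩ := exists_haar_norlundSum_maximal_le hm hbdd hq0 hq hα hC
  have hpoly : ∀ g : Gm m → ℂ, Integrable g (haar m) → ∀ N : ℕ,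
      (∀ x y : Gm m, (∀ i < N, x i = y i) → g x = g y) → ∀ x,
      Tendsto (fun n : ℕ => norlundSum m q n g x / ((n : ℝ) ^ α : ℝ)) atTop (𝓝 (c * g x)) := by
    intro g hg N hgN x
    have hlim : Tendsto (fun k => partialSum m k g x) atTop (𝓝 (g x)) :=
      tendsto_const_nhds.congr' (eventually_atTop.2
        ⟨M m N, fun n hn => (partialSum_eq hm hg hgN hn x).symm⟩)
    have hpow : Tendsto (fun n : ℕ => (n : ℝ) ^ α) atTop atTop :=
      (tendsto_rpow_atTop hα).comp tendsto_natCast_atTop_atTop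
    have := tendsto_sum_mul_of_tendsto (w := fun n k => q (n - k) / (n : ℝ) ^ α)
      (fun n k _ => div_nonneg (hq0 _) (by positivity)) (s := c) (hc.congr fun n => ?_)
      (fun k _ => ?_) hlim
    · refine this.congr fun n => ?_
      rw [norlundSum, Finset.sum_div]
      refine Finset.sum_congr rfl fun k _ => ?_
      push_cast
      ring
    · rw [← Finset.sum_div, sum_Icc_one_tsub, sumQ]
    · have hbound : ∀ j, q j ≤ max (q 0) (q 1) := fun j => by
        rcases Nat.eq_zero_or_pos j with rfl | hj
        · exact le_max_left _ _
        · exact (hq 1 j le_rfl hj).trans (le_max_right _ _)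
      refine squeeze_zero (fun n => div_nonneg (hq0 _) (by positivity)) (fun n => ?_)
        (hpow.const_div_atTop (max (q 0) (q 1)))
      gcongr
      exact hbound _
  -- split `f = (f - g) + g` with `g` a function of finitely many coordinates close to `f` in `L_1`
  have hbad : ∀ ε : ℝ, 0 < ε → haar m {x | ∃ᶠ n : ℕ in atTop,
      ε ≤ ‖norlundSum m q n f x / ((n : ℝ) ^ α : ℝ) - c * f x‖} = 0 := by
    intro ε hε
    set D : ℝ≥0∞ := ENNReal.ofReal (K / (ε / 3)) + ENNReal.ofReal ((c + 1) / (ε / 3)) with hD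
    have hDtop : D ≠ ∞ := by simp [hD]
    refine le_antisymm (ENNReal.le_of_forall_pos_le_add fun δ hδ _ => ?_) zero_le
    rw [zero_add]
    obtain ⟨N, g, hg, hgN, hfg⟩ := exists_approx hm hf (ε := δ / (D + 1))
      (ENNReal.div_pos (by exact_mod_cast hδ.ne') (by simp [hDtop]))
    have hfgi : Integrable (fun y => f y - g y) (haar m) := hf.sub hg
    have hsub : {x | ∃ᶠ n : ℕ in atTop,
        ε ≤ ‖norlundSum m q n f x / ((n : ℝ) ^ α : ℝ) - c * f x‖} ⊆
        {x | ∃ n : ℕ, 1 ≤ n ∧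
          ε / 3 * (n : ℝ) ^ α < ‖norlundSum m q n (fun y => f y - g y) x‖} ∪
        {x | ENNReal.ofReal (ε / 3 / (c + 1)) ≤ ‖f x - g x‖ₑ} := by
      intro x hx
      by_contra hcon
      simp only [Set.mem_union, Set.mem_ofPred_eq, not_or, not_exists, not_and, not_lt,
        not_le] at hcon
      obtain ⟨h1, h2⟩ := hcon
      have h3 : c * ‖f x - g x‖ ≤ ε / 3 := by
        rw [← ofReal_norm, ENNReal.ofReal_lt_ofReal_iff (by positivity),
          lt_div_iff₀ (by positivity)] at h2
        nlinarith [norm_nonneg (f x - g x)]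
      have h4 := Metric.tendsto_atTop.1 (hpoly g hg N hgN x) (ε / 3) (by positivity)
      obtain ⟨n₀, hn₀⟩ := h4
      refine hx (eventually_atTop.2 ⟨max n₀ 1, fun n hn => not_le.2 ?_⟩)
      have hn1 : 1 ≤ n := (le_max_right _ _).trans hn
      have h5 := hn₀ n ((le_max_left _ _).trans hn)
      have h6 := h1 n hn1
      have hpos : (0 : ℝ) < (n : ℝ) ^ α := by positivity
      have h7 : ‖norlundSum m q n (fun y => f y - g y) x / ((n : ℝ) ^ α : ℝ)‖ ≤ ε / 3 := by
        rw [norm_div, Complex.norm_real, Real.norm_of_nonneg hpos.le, div_le_iff₀ hpos]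
        exact h6
      have h8 : ‖(c : ℂ) * (f x - g x)‖ ≤ ε / 3 := by
        rwa [norm_mul, Complex.norm_real, Real.norm_of_nonneg hc0]
      rw [dist_eq_norm] at h5
      have hsplit : norlundSum m q n f x / ((n : ℝ) ^ α : ℝ) - c * f x =
          norlundSum m q n (fun y => f y - g y) x / ((n : ℝ) ^ α : ℝ) +
          (norlundSum m q n g x / ((n : ℝ) ^ α : ℝ) - c * g x) - c * (f x - g x) := by
        rw [norlundSum_sub hm hf hg]
        ring
      rw [hsplit]
      calc _ ≤ _ := norm_sub_le _ _
        _ ≤ _ := add_le_add (norm_add_le _ _) le_rfl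
        _ < ε := by linarith
    have hmarkov : haar m {x | ENNReal.ofReal (ε / 3 / (c + 1)) ≤ ‖f x - g x‖ₑ} ≤
        ENNReal.ofReal ((c + 1) / (ε / 3)) * ∫⁻ x, ‖f x - g x‖ₑ ∂(haar m) := by
      have h1 := mul_meas_ge_le_lintegral₀ hfgi.aestronglyMeasurable.enorm
        (ENNReal.ofReal (ε / 3 / (c + 1)))
      have h2 : ENNReal.ofReal ((c + 1) / (ε / 3)) * ENNReal.ofReal (ε / 3 / (c + 1)) = 1 := by
        rw [← ENNReal.ofReal_mul (by positivity), ← ENNReal.ofReal_one]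
        congr 1
        field_simp
      calc _ = ENNReal.ofReal ((c + 1) / (ε / 3)) * (ENNReal.ofReal (ε / 3 / (c + 1)) *
            haar m {x | ENNReal.ofReal (ε / 3 / (c + 1)) ≤ ‖f x - g x‖ₑ}) := by
            rw [← mul_assoc, h2, one_mul]
        _ ≤ _ := by gcongr
    calc _ ≤ D * ∫⁻ x, ‖f x - g x‖ₑ ∂(haar m) := by
          rw [hD, add_mul]
          exact (measure_mono hsub).trans ((measure_union_le _ _).trans
            (add_le_add (hK _ hfgi _ (by positivity)) hmarkov))
      _ ≤ (D + 1) * (δ / (D + 1)) := mul_le_mul' le_self_add hfg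
      _ = δ := ENNReal.mul_div_cancel (by simp) (by simp [hDtop])
  have hall : ∀ᵐ x ∂(haar m), ∀ k : ℕ, ¬ ∃ᶠ n : ℕ in atTop,
      1 / ((k : ℝ) + 1) ≤ ‖norlundSum m q n f x / ((n : ℝ) ^ α : ℝ) - c * f x‖ :=
    ae_all_iff.2 fun k => by
      rw [ae_iff]
      simpa only [not_not] using hbad (1 / ((k : ℝ) + 1)) (by positivity)
  filter_upwards [hall] with x hx
  rw [Metric.tendsto_atTop]
  intro ε hε
  obtain ⟨k, hk⟩ := exists_nat_one_div_lt hε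
  obtain ⟨n₀, hn₀⟩ := eventually_atTop.1 (not_frequently.1 (hx k))
  refine ⟨n₀, fun n hn => ?_⟩
  rw [dist_eq_norm]
  exact (not_le.1 (hn₀ n hn)).trans hk

end Convergence

/-! ### Fejér and Cesàro means and the means `V_n^α` -/

section Cesaro

variable {m : ℕ → ℕ} {q : ℕ → ℝ}

/-- Passing to any normalization `Z_n` equivalent to `c n^α`. -/
theorem ae_tendsto_norlundSum_div (hm : ∀ k, 2 ≤ m k) (hbdd : BddAbove (Set.range m))
    (hq0 : ∀ k, 0 ≤ q k) (hq : ∀ i j, 1 ≤ i → i ≤ j → q j ≤ q i) {α c : ℝ} (hα : 0 < α)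
    (hc : Tendsto (fun n : ℕ => sumQ q n / (n : ℝ) ^ α) atTop (𝓝 c)) (hc0 : c ≠ 0)
    {Z : ℕ → ℝ} (hZ : Tendsto (fun n : ℕ => Z n / (n : ℝ) ^ α) atTop (𝓝 c)) {f : Gm m → ℂ}
    (hf : Integrable f (haar m)) :
    ∀ᵐ x ∂(haar m), Tendsto (fun n : ℕ => norlundSum m q n f x / (Z n : ℂ)) atTop
      (𝓝 (f x)) := by
  filter_upwards [ae_tendsto_norlundSum hm hbdd hq0 hq hα hc hf] with x hx
  have hc0' : (c : ℂ) ≠ 0 := by exact_mod_cast hc0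
  have h := hx.div ((Complex.continuous_ofReal.tendsto c).comp hZ) hc0'
  rw [mul_div_cancel_left₀ _ hc0'] at h
  refine h.congr' (eventually_atTop.2 ⟨1, fun n hn => ?_⟩)
  have hn0 : (((n : ℝ) ^ α : ℝ) : ℂ) ≠ 0 := by
    have : (0 : ℝ) < (n : ℝ) ^ α := by positivity
    exact_mod_cast this.ne'
  simp only [Pi.div_apply, Function.comp_apply, Complex.ofReal_div]
  rw [div_div_div_cancel_right₀ hn0]

theorem tendsto_const_div_natCast_rpow {α : ℝ} (hα : 0 < α) (b : ℝ) :
    Tendsto (fun n : ℕ => b / (n : ℝ) ^ α) atTop (𝓝 0) :=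
  ((tendsto_rpow_atTop hα).comp tendsto_natCast_atTop_atTop).const_div_atTop b

theorem ae_tendsto_fejerMean (hm : ∀ k, 2 ≤ m k) (hbdd : BddAbove (Set.range m)) {f : Gm m → ℂ}
    (hf : Integrable f (haar m)) :
    ∀ᵐ x ∂(haar m), Tendsto (fun n : ℕ => fejerMean m n f x) atTop (𝓝 (f x)) := by
  have hc : Tendsto (fun n : ℕ => (n : ℝ) / (n : ℝ) ^ (1 : ℝ)) atTop (𝓝 1) :=
    tendsto_const_nhds.congr' (eventually_atTop.2 ⟨1, fun n hn => by
      beta_reduce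
      rw [Real.rpow_one, div_self (by positivity)]⟩)
  have h := ae_tendsto_norlundSum_div hm hbdd (q := fun _ => 1) (fun _ => zero_le_one)
    (fun _ _ _ _ => le_rfl) one_pos (by simpa [sumQ] using hc) one_ne_zero hc hf
  simpa [norlundSum, fejerMean] using h

theorem cesaroNumber_succ (a₀ α : ℝ) {n : ℕ} (hn : 1 ≤ n) :
    cesaroNumber a₀ α (n + 1) = cesaroNumber a₀ α n * ((α + (n + 1)) / (n + 1)) := by
  rw [cesaroNumber, cesaroNumber, if_neg (by omega), if_neg (by omega),
    Finset.prod_Icc_succ_top (by omega), Nat.factorial_succ]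
  push_cast
  rw [div_mul_div_comm, mul_comm (n + 1 : ℝ)]

theorem cesaroNumber_one_succ (α : ℝ) (n : ℕ) :
    cesaroNumber 1 α (n + 1) = cesaroNumber 1 α n * ((α + (n + 1)) / (n + 1)) := by
  rcases Nat.eq_zero_or_pos n with rfl | hn
  · simp [cesaroNumber]
  · exact cesaroNumber_succ 1 α hn

theorem cesaroNumber_eq_of_pos (a₀ α : ℝ) {n : ℕ} (hn : 1 ≤ n) :
    cesaroNumber a₀ α n = cesaroNumber 1 α n := by
  rw [cesaroNumber, cesaroNumber, if_neg (by omega), if_neg (by omega)]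

theorem cesaroNumber_sub_one_succ (α : ℝ) (n : ℕ) :
    cesaroNumber 1 (α - 1) (n + 1) = α / (n + 1) * cesaroNumber 1 α n := by
  induction n with
  | zero => simp [cesaroNumber]
  | succ n ih =>
    rw [cesaroNumber_one_succ, ih, cesaroNumber_one_succ]
    have : (n : ℝ) + 1 ≠ 0 := by positivity
    have : (n : ℝ) + 1 + 1 ≠ 0 := by positivity
    push_cast
    field_simp
    ring

theorem cesaroNumber_nonneg {a₀ α : ℝ} (ha : 0 ≤ a₀) (hα : -1 ≤ α) (n : ℕ) :
    0 ≤ cesaroNumber a₀ α n := by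
  rw [cesaroNumber]
  split_ifs
  · exact ha
  · refine div_nonneg (Finset.prod_nonneg fun j hj => ?_) (by positivity)
    have : (1 : ℝ) ≤ j := by exact_mod_cast (Finset.mem_Icc.1 hj).1
    linarith

theorem cesaroNumber_anti {a₀ α : ℝ} (ha : 0 ≤ a₀) (hα : -1 ≤ α) (hα' : α ≤ 0) {i j : ℕ}
    (hi : 1 ≤ i) (hij : i ≤ j) : cesaroNumber a₀ α j ≤ cesaroNumber a₀ α i := by
  induction j, hij using Nat.le_induction with
  | base => exact le_rfl
  | succ j hij ih =>
    refine le_trans ?_ ih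
    rw [cesaroNumber_succ a₀ α (hi.trans hij)]
    refine mul_le_of_le_one_right (cesaroNumber_nonneg ha hα j) ?_
    rw [div_le_one (by positivity)]
    linarith

/-- The telescoping identity `A_0^{α-1} + ⋯ + A_n^{α-1} = A_n^α`, with the first summand replaced by
`a₀` and the last one omitted. -/
theorem sumQ_cesaroNumber (a₀ α : ℝ) {n : ℕ} (hn : 1 ≤ n) :
    sumQ (cesaroNumber a₀ (α - 1)) n =
      cesaroNumber 1 α n - cesaroNumber 1 (α - 1) n + (a₀ - 1) := by
  induction n, hn using Nat.le_induction with
  | base => simp [sumQ, cesaroNumber]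
  | succ n hn ih =>
    rw [sumQ, Finset.sum_range_succ, ← sumQ, ih, cesaroNumber_eq_of_pos a₀ _ hn,
      cesaroNumber_one_succ, cesaroNumber_sub_one_succ]
    have : (n : ℝ) + 1 ≠ 0 := by positivity
    field_simp
    ring

/-- Euler's limit formula for the Gamma function gives the order of the Cesàro numbers. -/
theorem tendsto_cesaroNumber_div {α : ℝ} (hα : 0 < α) :
    Tendsto (fun n : ℕ => cesaroNumber 1 α n / (n : ℝ) ^ α) atTop
      (𝓝 (α * Real.Gamma α)⁻¹) := by
  have hΓ : α * Real.Gamma α ≠ 0 := (mul_pos hα (Real.Gamma_pos_of_pos hα)).ne'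
  refine (((Real.GammaSeq_tendsto_Gamma α).const_mul α).inv₀ hΓ).congr fun n => ?_
  have hprod : ∏ j ∈ Finset.range (n + 1), (α + j) = α * (cesaroNumber 1 α n * n.factorial) := by
    induction n with
    | zero => simp [cesaroNumber]
    | succ n ih =>
      rw [Finset.prod_range_succ, ih, cesaroNumber_one_succ, Nat.factorial_succ]
      have : (n : ℝ) + 1 ≠ 0 := by positivity
      push_cast
      field_simp
  have hfac : (n.factorial : ℝ) ≠ 0 := by positivity
  rw [Real.GammaSeq, hprod]
  field_simp

theorem ae_tendsto_cesaroMean (hm : ∀ k, 2 ≤ m k) (hbdd : BddAbove (Set.range m)) {a₀ α : ℝ}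
    (ha : 0 ≤ a₀) (hα : 0 < α) (hα' : α ≤ 1) {f : Gm m → ℂ} (hf : Integrable f (haar m)) :
    ∀ᵐ x ∂(haar m), Tendsto (fun n : ℕ => cesaroMean m a₀ α n f x) atTop (𝓝 (f x)) := by
  have hlim := tendsto_cesaroNumber_div hα
  have hZ : Tendsto (fun n : ℕ => cesaroNumber a₀ α n / (n : ℝ) ^ α) atTop
      (𝓝 (α * Real.Gamma α)⁻¹) :=
    hlim.congr' (eventually_atTop.2 ⟨1, fun n hn => by
      beta_reduce
      rw [cesaroNumber_eq_of_pos a₀ α hn]⟩)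
  have h1 : Tendsto (fun n : ℕ => cesaroNumber 1 (α - 1) n / (n : ℝ) ^ α) atTop (𝓝 0) := by
    refine squeeze_zero' (Eventually.of_forall fun n => div_nonneg
      (cesaroNumber_nonneg zero_le_one (by linarith) n) (by positivity))
      (eventually_atTop.2 ⟨1, fun n hn => ?_⟩)
      (tendsto_const_div_natCast_rpow hα (cesaroNumber 1 (α - 1) 1))
    gcongr
    exact cesaroNumber_anti zero_le_one (by linarith) (by linarith) le_rfl hn
  have hc : Tendsto (fun n : ℕ => sumQ (cesaroNumber a₀ (α - 1)) n / (n : ℝ) ^ α) atTop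
      (𝓝 (α * Real.Gamma α)⁻¹) := by
    have := (hlim.sub h1).add (tendsto_const_div_natCast_rpow hα (a₀ - 1))
    rw [sub_zero, add_zero] at this
    refine this.congr' (eventually_atTop.2 ⟨1, fun n hn => ?_⟩)
    beta_reduce
    rw [sumQ_cesaroNumber a₀ α hn]
    ring
  exact ae_tendsto_norlundSum_div hm hbdd (fun k => cesaroNumber_nonneg ha (by linarith) k)
    (fun i j hi hij => cesaroNumber_anti ha (by linarith) (by linarith) hi hij) hα hc
    (inv_ne_zero (mul_pos hα (Real.Gamma_pos_of_pos hα)).ne') hZ hf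

theorem rpow_add_one_sub_rpow_le {α : ℝ} (hα : 0 ≤ α) (hα' : α ≤ 1) {x : ℝ} (hx : 0 < x) :
    (x + 1) ^ α - x ^ α ≤ α * x ^ (α - 1) := by
  have h := rpow_one_add_le_one_add_mul_self (s := 1 / x) (p := α)
    (by have : 0 < 1 / x := by positivity
        linarith) hα hα'
  have h1 : (x + 1) ^ α = x ^ α * (1 + 1 / x) ^ α := by
    rw [← Real.mul_rpow hx.le (by positivity)]
    congr 1
    field_simp
  rw [h1, Real.rpow_sub_one hx.ne']
  have := mul_le_mul_of_nonneg_left h (Real.rpow_nonneg hx.le α)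
  have h2 : x ^ α * (1 + α * (1 / x)) = x ^ α + α * (x ^ α / x) := by field_simp
  linarith

theorem le_rpow_sub_sub_one_rpow {α : ℝ} (hα : 0 ≤ α) (hα' : α ≤ 1) {x : ℝ} (hx : 1 ≤ x) :
    α * x ^ (α - 1) ≤ x ^ α - (x - 1) ^ α := by
  have hx0 : 0 < x := by linarith
  have hx1 : 1 / x ≤ 1 := by rw [div_le_one hx0]; exact hx
  have h := rpow_one_add_le_one_add_mul_self (s := -(1 / x)) (p := α) (by linarith) hα hα'
  have h1 : (x - 1) ^ α = x ^ α * (1 + -(1 / x)) ^ α := by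
    rw [← Real.mul_rpow hx0.le (by linarith)]
    congr 1
    field_simp
    ring
  rw [h1, Real.rpow_sub_one hx0.ne']
  have := mul_le_mul_of_nonneg_left h (Real.rpow_nonneg hx0.le α)
  have h2 : x ^ α * (1 + α * -(1 / x)) = x ^ α - α * (x ^ α / x) := by field_simp; ring
  linarith

theorem sumQ_qV_bounds {α : ℝ} (hα : 0 < α) (hα' : α ≤ 1) (n : ℕ) :
    1 + (((n : ℝ) + 1) ^ α - 1) / α ≤ sumQ (qV α) (n + 1) ∧
      sumQ (qV α) (n + 1) ≤ 1 + (n : ℝ) ^ α / α := by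
  induction n with
  | zero => simp [sumQ, qV, Real.zero_rpow hα.ne']
  | succ n ih =>
    rw [sumQ, Finset.sum_range_succ, ← sumQ, qV, if_neg (by omega)]
    push_cast
    have h1 := rpow_add_one_sub_rpow_le hα.le hα' (x := (n : ℝ) + 1) (by positivity)
    have h2 := le_rpow_sub_sub_one_rpow hα.le hα' (x := (n : ℝ) + 1)
      (by have : (0 : ℝ) ≤ n := by positivity
          linarith)
    rw [add_sub_cancel_right] at h2
    rw [← le_div_iff₀' hα] at h2
    rw [← div_le_iff₀' hα] at h1
    constructor
    · calc _ = 1 + (((n : ℝ) + 1) ^ α - 1) / α +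
          (((n : ℝ) + 1 + 1) ^ α - ((n : ℝ) + 1) ^ α) / α := by ring
        _ ≤ _ := add_le_add ih.1 h1
    · calc _ ≤ 1 + (n : ℝ) ^ α / α + (((n : ℝ) + 1) ^ α - (n : ℝ) ^ α) / α := add_le_add ih.2 h2
        _ = _ := by ring

theorem tendsto_sumQ_qV_div {α : ℝ} (hα : 0 < α) (hα' : α ≤ 1) :
    Tendsto (fun n : ℕ => sumQ (qV α) n / (n : ℝ) ^ α) atTop (𝓝 α⁻¹) := by
  have hl := (tendsto_const_div_natCast_rpow hα (1 - 1 / α)).add_const α⁻¹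
  have hu := (tendsto_const_div_natCast_rpow hα 1).add_const α⁻¹
  rw [zero_add] at hl hu
  refine tendsto_of_tendsto_of_tendsto_of_le_of_le' hl hu ?_ ?_ <;>
    refine eventually_atTop.2 ⟨1, fun n hn => ?_⟩ <;>
    have hpos : (0 : ℝ) < (n : ℝ) ^ α := by positivity
  all_goals
    obtain ⟨k, rfl⟩ := Nat.exists_eq_add_of_le' hn
    obtain ⟨h1, h2⟩ := sumQ_qV_bounds hα hα' k
  · rw [le_div_iff₀ hpos, add_mul, div_mul_cancel₀ _ hpos.ne']
    refine le_trans (le_of_eq ?_) h1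
    push_cast
    field_simp
    ring
  · rw [div_le_iff₀ hpos, add_mul, div_mul_cancel₀ _ hpos.ne']
    refine h2.trans ?_
    have : (k : ℝ) ^ α ≤ ((k + 1 : ℕ) : ℝ) ^ α := by
      gcongr
      exact Nat.le_succ k
    rw [inv_mul_eq_div]
    gcongr

theorem ae_tendsto_VMean (hm : ∀ k, 2 ≤ m k) (hbdd : BddAbove (Set.range m)) {α : ℝ}
    (hα : 0 < α) (hα' : α ≤ 1) {f : Gm m → ℂ} (hf : Integrable f (haar m)) :
    (∀ᵐ x ∂(haar m), Tendsto (fun n : ℕ => VMean m α n f x) atTop (𝓝 (f x))) ∧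
    (∀ᵐ x ∂(haar m), Tendsto (fun n : ℕ => norlundMean m (qV α) n f x) atTop (𝓝 (f x))) := by
  have hc := tendsto_sumQ_qV_div hα hα'
  have hanti : ∀ i j : ℕ, 1 ≤ i → i ≤ j → (j : ℝ) ^ (α - 1) ≤ (i : ℝ) ^ (α - 1) :=
    fun i j hi hij => Real.rpow_le_rpow_of_nonpos (by exact_mod_cast hi) (by exact_mod_cast hij)
      (by linarith)
  constructor
  · -- `V_n^α` is formed with `q_0 = 0` in the numerator
    set q' : ℕ → ℝ := fun k => if k = 0 then 0 else (k : ℝ) ^ (α - 1) with hq'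
    have hsum : ∀ n, 1 ≤ n → sumQ q' n = sumQ (qV α) n - 1 := by
      intro n hn
      obtain ⟨k, rfl⟩ := Nat.exists_eq_add_of_le' hn
      rw [sumQ, sumQ, Finset.sum_range_succ', Finset.sum_range_succ']
      simp [hq', qV]
    have hc' : Tendsto (fun n : ℕ => sumQ q' n / (n : ℝ) ^ α) atTop (𝓝 α⁻¹) := by
      have := hc.sub (tendsto_const_div_natCast_rpow hα 1)
      rw [sub_zero] at this
      refine this.congr' (eventually_atTop.2 ⟨1, fun n hn => ?_⟩)
      beta_reduce
      rw [hsum n hn]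
      ring
    have h := ae_tendsto_norlundSum_div hm hbdd (q := q')
      (fun k => by simp only [hq']; split_ifs <;> positivity)
      (fun i j hi hij => by
        simp only [hq']
        rw [if_neg (by omega), if_neg (by omega)]
        exact hanti i j hi hij) hα hc' (inv_ne_zero hα.ne') hc hf
    filter_upwards [h] with x hx
    refine hx.congr' (eventually_atTop.2 ⟨1, fun n hn => ?_⟩)
    beta_reduce
    rw [VMean, norlundSum]
    congr 1
    rw [Finset.range_eq_Ico, Finset.sum_eq_sum_Ico_succ_bot (by omega),
      ← Finset.Ico_insert_right hn, Finset.sum_insert (by simp)]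
    congr 1
    · simp [hq', partialSum]
    · refine Finset.sum_congr rfl fun k hk => ?_
      have hk' := Finset.mem_Ico.1 hk
      simp only [hq']
      rw [if_neg (by omega), Nat.cast_sub (by omega)]
  · exact ae_tendsto_norlundSum_div hm hbdd (q := qV α)
      (fun k => by rw [qV]; split_ifs <;> positivity)
      (fun i j hi hij => by
        rw [qV, qV, if_neg (by omega), if_neg (by omega)]
        exact hanti i j hi hij) hα hc (inv_ne_zero hα.ne') hc hf

end Cesaro

/-! ### Iterated logarithms and the means `B_n^{α,β}` -/

section Logarithmic

variable {m : ℕ → ℕ}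

theorem sum_mul_eq_sum_sub_mul_sum (u s : ℕ → ℂ) (n : ℕ) :
    ∑ k ∈ Finset.Icc 1 n, u k * s k =
      ∑ k ∈ Finset.Icc 1 n, (u k - u (k + 1)) * ∑ i ∈ Finset.Icc 1 k, s i +
        u (n + 1) * ∑ i ∈ Finset.Icc 1 n, s i := by
  induction n with
  | zero => simp
  | succ n ih =>
    rw [Finset.sum_Icc_succ_top (by omega), ih, Finset.sum_Icc_succ_top (by omega),
      Finset.sum_Icc_succ_top (b := n) (f := s) (by omega)]
    ring

/-- If the arithmetic means of a sequence converge, then so do all its means with weights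
`w_{n,1} ≥ w_{n,2} ≥ ⋯ ≥ w_{n,n} ≥ 0`: by Abel's transformation these are averages of the arithmetic
means. -/
theorem tendsto_sum_mul_of_tendsto_mean {w : ℕ → ℕ → ℝ}
    (hw0 : ∀ n, ∀ k ∈ Finset.Icc 1 n, 0 ≤ w n k)
    (hw : ∀ n i j, 1 ≤ i → i ≤ j → j ≤ n → w n j ≤ w n i)
    (hsum : Tendsto (fun n => ∑ k ∈ Finset.Icc 1 n, w n k) atTop (𝓝 1))
    (hw1 : Tendsto (fun n => w n 1) atTop (𝓝 0)) {s : ℕ → ℂ} {L : ℂ}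
    (hs : Tendsto (fun n : ℕ => (∑ k ∈ Finset.Icc 1 n, s k) / (n : ℂ)) atTop (𝓝 L)) :
    Tendsto (fun n => ∑ k ∈ Finset.Icc 1 n, (w n k : ℂ) * s k) atTop (𝓝 L) := by
  -- extension by zero turns the boundary term of the Abel transformation into `w' n (n + 1) = 0`
  set w' : ℕ → ℕ → ℝ := fun n k => if k ≤ n then w n k else 0 with hw'
  have h0 : ∀ n k, 1 ≤ k → 0 ≤ w' n k := fun n k hk => by
    simp only [hw']
    split_ifs with h
    · exact hw0 n k (Finset.mem_Icc.2 ⟨hk, h⟩)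
    · exact le_rfl
  have hanti : ∀ n i j, 1 ≤ i → i ≤ j → w' n j ≤ w' n i := fun n i j hi hij => by
    by_cases hj : j ≤ n
    · simp only [hw', if_pos hj, if_pos (hij.trans hj)]
      exact hw n i j hi hij hj
    · rw [show w' n j = 0 from if_neg hj]
      exact h0 n i hi
  have habel : ∀ (a : ℕ → ℂ) (n : ℕ), ∑ k ∈ Finset.Icc 1 n, (w n k : ℂ) * a k =
      ∑ k ∈ Finset.Icc 1 n, ((k * (w' n k - w' n (k + 1)) : ℝ) : ℂ) *
        ((∑ i ∈ Finset.Icc 1 k, a i) / (k : ℂ)) := by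
    intro a n
    have h1 := sum_mul_eq_sum_sub_mul_sum (fun k => (w' n k : ℂ)) a n
    rw [show w' n (n + 1) = 0 from if_neg (by omega)] at h1
    rw [Complex.ofReal_zero, zero_mul, add_zero] at h1
    have h2 : ∑ k ∈ Finset.Icc 1 n, (w n k : ℂ) * a k =
        ∑ k ∈ Finset.Icc 1 n, (w' n k : ℂ) * a k :=
      Finset.sum_congr rfl fun k hk => by
        rw [show w' n k = w n k from if_pos (Finset.mem_Icc.1 hk).2]
    rw [h2, h1]
    refine Finset.sum_congr rfl fun k hk => ?_
    have hk0 : (k : ℂ) ≠ 0 := by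
      have := (Finset.mem_Icc.1 hk).1
      exact_mod_cast (by omega : k ≠ 0)
    push_cast
    field_simp
  have key := tendsto_sum_mul_of_tendsto (w := fun n k => k * (w' n k - w' n (k + 1)))
    (fun n k hk => mul_nonneg (by positivity)
      (sub_nonneg.2 (hanti n k (k + 1) (Finset.mem_Icc.1 hk).1 (Nat.le_succ k))))
    (s := 1) (hsum.congr fun n => ?_) (fun k hk => ?_) hs
  · rw [Complex.ofReal_one, one_mul] at key
    exact key.congr fun n => (habel s n).symm
  · have h1 := habel (fun _ => 1) n
    simp only [mul_one] at h1
    have h2 : ∑ k ∈ Finset.Icc 1 n, ((k * (w' n k - w' n (k + 1)) : ℝ) : ℂ) *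
        ((∑ i ∈ Finset.Icc 1 k, (1 : ℂ)) / (k : ℂ)) =
        ∑ k ∈ Finset.Icc 1 n, ((k * (w' n k - w' n (k + 1)) : ℝ) : ℂ) := by
      refine Finset.sum_congr rfl fun k hk => ?_
      have hk0 : (k : ℂ) ≠ 0 := by
        have := (Finset.mem_Icc.1 hk).1
        exact_mod_cast (by omega : k ≠ 0)
      simp [hk0]
    rw [h2] at h1
    exact_mod_cast h1
  · have hk0 : Tendsto (fun n => (k : ℝ) * w' n 1) atTop (𝓝 0) := by
      rw [← mul_zero (k : ℝ)]
      refine Tendsto.const_mul _ (hw1.congr' (eventually_atTop.2 ⟨1, fun n hn => ?_⟩))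
      exact (if_pos hn).symm
    refine squeeze_zero (fun n => mul_nonneg (by positivity)
      (sub_nonneg.2 (hanti n k (k + 1) hk (Nat.le_succ k)))) (fun n => ?_) hk0
    gcongr
    linarith [hanti n 1 k le_rfl hk, h0 n (k + 1) (by omega)]

theorem iterLog_succ (β : ℕ) (x : ℝ) : iterLog (β + 1) x = iterLog β (Real.posLog x) :=
  Function.iterate_succ_apply _ _ _

theorem iterLog_nonneg (β : ℕ) {x : ℝ} (hx : 0 ≤ x) : 0 ≤ iterLog β x := by
  induction β generalizing x with
  | zero => exact hx
  | succ β ih => rw [iterLog_succ]; exact ih Real.posLog_nonneg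

theorem iterLog_mono (β : ℕ) {x y : ℝ} (hx : 0 ≤ x) (hxy : x ≤ y) :
    iterLog β x ≤ iterLog β y := by
  induction β generalizing x y with
  | zero => exact hxy
  | succ β ih =>
    rw [iterLog_succ, iterLog_succ]
    exact ih Real.posLog_nonneg (Real.posLog_le_posLog hx hxy)

theorem iterLog_zero_right (β : ℕ) : iterLog β 0 = 0 := by
  induction β with
  | zero => rfl
  | succ β ih => rw [iterLog_succ, Real.posLog_zero, ih]

theorem posLog_sub_le_sub {x y : ℝ} (hy : 0 ≤ y) (hxy : y ≤ x) :
    Real.posLog x - Real.posLog y ≤ x - y := by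
  rw [Real.posLog_eq_log_max_one hy, Real.posLog_eq_log_max_one (hy.trans hxy)]
  have h1 : 0 < max 1 y := lt_max_of_lt_left one_pos
  have h2 : 0 < max 1 x := lt_max_of_lt_left one_pos
  have h3 : max 1 y ≤ max 1 x := max_le_max le_rfl hxy
  rw [← Real.log_div h2.ne' h1.ne']
  calc _ ≤ max 1 x / max 1 y - 1 := Real.log_le_sub_one_of_pos (by positivity)
    _ = (max 1 x - max 1 y) / max 1 y := by field_simp
    _ ≤ max 1 x - max 1 y := div_le_self (by linarith) (le_max_left _ _)
    _ ≤ x - y := by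
      rcases le_total 1 y with h | h
      · rw [max_eq_right h, max_eq_right (h.trans hxy)]
      · rw [max_eq_left h]
        rcases le_total 1 x with h' | h'
        · rw [max_eq_right h']; linarith
        · rw [max_eq_left h']; linarith

theorem iterLog_sub_le_sub (β : ℕ) {x y : ℝ} (hy : 0 ≤ y) (hxy : y ≤ x) :
    iterLog β x - iterLog β y ≤ x - y := by
  induction β generalizing x y with
  | zero => exact le_rfl
  | succ β ih =>
    rw [iterLog_succ, iterLog_succ]
    exact (ih Real.posLog_nonneg (Real.posLog_le_posLog hy hxy)).trans (posLog_sub_le_sub hy hxy)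

/-- An iterated logarithm grows at most like the logarithm, as `log⁺` is nonexpansive. -/
theorem iterLog_sub_le_log_sub_log {β : ℕ} (hβ : 1 ≤ β) {x y : ℝ} (hy : 0 < y) (hxy : y ≤ x) :
    iterLog β x - iterLog β y ≤ Real.log x - Real.log y := by
  obtain ⟨β, rfl⟩ := Nat.exists_eq_add_of_le' hβ
  rw [iterLog_succ, iterLog_succ]
  refine (iterLog_sub_le_sub β Real.posLog_nonneg (Real.posLog_le_posLog hy.le hxy)).trans ?_
  have h := Real.log_le_log hy hxy
  rw [Real.posLog_apply, Real.posLog_apply]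
  rcases le_total 0 (Real.log y) with h1 | h1
  · rw [max_eq_right h1, max_eq_right (h1.trans h)]
  · rw [max_eq_left h1]
    rcases le_total 0 (Real.log x) with h2 | h2
    · rw [max_eq_right h2]; linarith
    · rw [max_eq_left h2]; linarith

theorem tendsto_iterLog_atTop (β : ℕ) : Tendsto (iterLog β) atTop atTop := by
  induction β with
  | zero => exact tendsto_id
  | succ β ih =>
    have h : Tendsto Real.posLog atTop atTop :=
      tendsto_atTop_mono (fun x => le_max_right _ _) Real.tendsto_log_atTop
    exact (ih.comp h).congr fun x => (iterLog_succ β x).symm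

/-- A form of `n! ≥ (n / e)^n`. -/
theorem sum_log_sub_log_le (n : ℕ) :
    ∑ j ∈ Finset.Ico 1 n, (Real.log n - Real.log j) ≤ n := by
  have hlog : ∀ k : ℕ, ∑ j ∈ Finset.Ico 1 (k + 1), Real.log j = Real.log k.factorial := by
    intro k
    induction k with
    | zero => simp
    | succ k ih =>
      rw [Finset.sum_Ico_succ_top (by omega), ih, Nat.factorial_succ, Nat.cast_mul,
        Real.log_mul (by positivity) (by positivity), add_comm]
  rcases Nat.eq_zero_or_pos n with rfl | hn
  · simp
  have hn' : (0 : ℝ) < n := by positivity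
  have h1 : ∑ j ∈ Finset.Ico 1 n, (Real.log n - Real.log j) =
      n * Real.log n - Real.log n.factorial := by
    rw [← hlog n, Finset.sum_Ico_succ_top hn, Finset.sum_sub_distrib, Finset.sum_const,
      Nat.card_Ico, nsmul_eq_mul, Nat.cast_sub hn]
    push_cast
    ring
  have h2 := Real.log_le_log (by positivity) (Real.pow_div_factorial_le_exp n hn'.le n)
  rw [Real.log_div (by positivity) (by positivity), Real.log_pow, Real.log_exp] at h2
  linarith

/-- If `G_n → ∞` and the `n` numbers `a_{n,j} ∈ [0, G_n]` stay within `D + C log (n / j)` of `G_n`,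
then their sum is equivalent to `n G_n`. -/
theorem tendsto_sum_div {a : ℕ → ℕ → ℝ} {G : ℕ → ℝ} {C D : ℝ} (hC : 0 ≤ C)
    (hD : 0 ≤ D) (hG : Tendsto G atTop atTop) (ha0 : ∀ n, 0 ≤ a n 0)
    (ha : ∀ n, ∀ j < n, a n j ≤ G n)
    (ha' : ∀ n j, 1 ≤ j → j < n → G n - a n j ≤ D + C * (Real.log n - Real.log j)) :
    Tendsto (fun n : ℕ => (∑ j ∈ Finset.range n, a n j) / (n * G n)) atTop (𝓝 1) := by
  have hlow : Tendsto (fun n : ℕ => 1 - (D + C) / G n - 1 / (n : ℝ)) atTop (𝓝 1) := by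
    have := (tendsto_const_nhds (x := (1 : ℝ))).sub (hG.const_div_atTop (D + C)) |>.sub
      ((tendsto_natCast_atTop_atTop (R := ℝ)).const_div_atTop 1)
    simpa using this
  have hev : ∀ᶠ n : ℕ in atTop, 1 ≤ n ∧ 0 < G n :=
    (eventually_ge_atTop 1).and (hG.eventually_gt_atTop 0)
  refine tendsto_of_tendsto_of_tendsto_of_le_of_le' hlow tendsto_const_nhds ?_ ?_
  · filter_upwards [hev] with n ⟨hn, hGn⟩
    have hn' : (0 : ℝ) < n := by exact_mod_cast hn
    rw [le_div_iff₀ (by positivity)]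
    have h1 : ∑ j ∈ Finset.Ico 1 n, (G n - a n j) ≤ D * n + C * n := by
      calc _ ≤ ∑ j ∈ Finset.Ico 1 n, (D + C * (Real.log n - Real.log j)) :=
            Finset.sum_le_sum fun j hj => ha' n j (Finset.mem_Ico.1 hj).1 (Finset.mem_Ico.1 hj).2
        _ = D * (n - 1 : ℕ) + C * ∑ j ∈ Finset.Ico 1 n, (Real.log n - Real.log j) := by
            rw [Finset.sum_add_distrib, ← Finset.mul_sum]
            simp [mul_comm]
        _ ≤ _ := by
            gcongr
            · exact Nat.sub_le n 1
            · exact sum_log_sub_log_le n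
    have h2 : ∑ j ∈ Finset.range n, a n j = a n 0 + ∑ j ∈ Finset.Ico 1 n, a n j := by
      rw [Finset.range_eq_Ico, Finset.sum_eq_sum_Ico_succ_bot hn]
    rw [Finset.sum_sub_distrib, Finset.sum_const, Nat.card_Ico, nsmul_eq_mul,
      Nat.cast_sub hn] at h1
    have h3 : (1 - (D + C) / G n - 1 / (n : ℝ)) * (n * G n) = n * G n - (D + C) * n - G n := by
      field_simp
    rw [h3, h2]
    push_cast at h1
    linarith [ha0 n]
  · filter_upwards [hev] with n ⟨hn, hGn⟩
    have hn' : (0 : ℝ) < n := by exact_mod_cast hn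
    rw [div_le_one (by positivity)]
    calc _ ≤ ∑ _j ∈ Finset.range n, G n :=
          Finset.sum_le_sum fun j hj => ha n j (Finset.mem_range.1 hj)
      _ = n * G n := by simp

theorem qB_eq {α : ℝ} (hα : 0 < α) (β k : ℕ) : qB α β k = iterLog β ((k : ℝ) ^ α) := by
  rw [qB]
  split_ifs with h
  · rw [h, Nat.cast_zero, Real.zero_rpow hα.ne', iterLog_zero_right]
  · rfl

theorem qB_nonneg {α : ℝ} (hα : 0 < α) (β k : ℕ) : 0 ≤ qB α β k := by
  rw [qB_eq hα]
  exact iterLog_nonneg β (by positivity)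

theorem qB_mono {α : ℝ} (hα : 0 < α) (β : ℕ) : Monotone (qB α β) := fun i j hij => by
  rw [qB_eq hα, qB_eq hα]
  exact iterLog_mono β (by positivity) (by gcongr)

theorem tendsto_qB_atTop {α : ℝ} (hα : 0 < α) (β : ℕ) : Tendsto (qB α β) atTop atTop :=
  ((tendsto_iterLog_atTop β).comp ((tendsto_rpow_atTop hα).comp
    tendsto_natCast_atTop_atTop)).congr fun k => (qB_eq hα β k).symm

theorem tendsto_sumQ_qB_div {α : ℝ} {β : ℕ} (hα : 0 < α) (hβ : 1 ≤ β) :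
    Tendsto (fun n : ℕ => sumQ (qB α β) n / (n * qB α β n)) atTop (𝓝 1) := by
  refine tendsto_sum_div (a := fun _ j => qB α β j) hα.le le_rfl (tendsto_qB_atTop hα β)
    (fun _ => qB_nonneg hα β 0) (fun n j hj => qB_mono hα β hj.le) fun n j hj hjn => ?_
  have hj' : (0 : ℝ) < j := by exact_mod_cast hj
  have hn' : (0 : ℝ) < n := by exact_mod_cast hj.trans hjn.le
  rw [zero_add, qB_eq hα, qB_eq hα, mul_sub, ← Real.log_rpow hj', ← Real.log_rpow hn']
  exact iterLog_sub_le_log_sub_log hβ (by positivity) (by gcongr)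

/-- For `u = y / x ∈ [0, 1]` one has `1 - u^α ≥ min(1, α) (1 - u)`, by Bernoulli's inequality if
`α ≤ 1`. -/
theorem min_one_mul_le_rpow_sub_rpow {α x y : ℝ} (hα : 0 < α) (hx : 0 < x) (hy : 0 ≤ y)
    (hyx : y ≤ x) : min 1 α * (x ^ α * ((x - y) / x)) ≤ x ^ α - y ^ α := by
  set u := y / x with hu
  have hu0 : 0 ≤ u := by positivity
  have hu1 : u ≤ 1 := (div_le_one hx).2 hyx
  have hy' : y ^ α = x ^ α * u ^ α := by
    rw [← Real.mul_rpow hx.le hu0, hu, mul_div_cancel₀ _ hx.ne']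
  have hxy : (x - y) / x = 1 - u := by rw [hu]; field_simp
  have key : min 1 α * (1 - u) ≤ 1 - u ^ α := by
    rcases le_total 1 α with h | h
    · rw [min_eq_left h]
      have : u ^ α ≤ u ^ (1 : ℝ) := by
        rcases hu0.eq_or_lt with h0 | h0
        · rw [← h0, Real.zero_rpow hα.ne', Real.zero_rpow one_ne_zero]
        · exact Real.rpow_le_rpow_of_exponent_ge h0 hu1 h
      rw [Real.rpow_one] at this
      linarith
    · rw [min_eq_right h]
      have := rpow_one_add_le_one_add_mul_self (s := u - 1) (p := α) (by linarith) hα.le h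
      rw [add_sub_cancel] at this
      linarith
  rw [hxy, hy']
  have hxα : 0 ≤ x ^ α := by positivity
  calc _ = x ^ α * (min 1 α * (1 - u)) := by ring
    _ ≤ x ^ α * (1 - u ^ α) := by gcongr
    _ = _ := by ring

theorem tendsto_sum_iterLog_sub_div {α : ℝ} {β : ℕ} (hα : 0 < α) (hβ : 1 ≤ β) :
    Tendsto (fun n : ℕ => (∑ k ∈ Finset.Icc 1 n, iterLog β ((n : ℝ) ^ α - (k : ℝ) ^ α)) /
      (n * qB α β n)) atTop (𝓝 1) := by
  set c := min 1 α with hc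
  have hc0 : 0 < c := lt_min one_pos hα
  have hc1 : c ≤ 1 := min_le_left _ _
  have hlogc : 0 ≤ -Real.log c := neg_nonneg.2 (Real.log_nonpos hc0.le hc1)
  have hle : ∀ n j : ℕ, j ≤ n → ((n - j : ℕ) : ℝ) ^ α ≤ (n : ℝ) ^ α := fun n j _ => by
    gcongr
    exact Nat.sub_le _ _
  have h := tendsto_sum_div (a := fun n j => iterLog β ((n : ℝ) ^ α - ((n - j : ℕ) : ℝ) ^ α))
    (C := 1) zero_le_one hlogc (tendsto_qB_atTop hα β)
    (fun n => iterLog_nonneg β (sub_nonneg.2 (hle n 0 (Nat.zero_le n))))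
    (fun n j hj => ?_) (fun n j hj hjn => ?_)
  · refine h.congr fun n => ?_
    congr 1
    rw [← sum_Icc_one_tsub]
    refine Finset.sum_congr rfl fun k hk => ?_
    rw [Nat.sub_sub_self (Finset.mem_Icc.1 hk).2]
  · rw [qB_eq hα]
    refine iterLog_mono β (sub_nonneg.2 (hle n j hj.le)) ?_
    have : (0 : ℝ) ≤ ((n - j : ℕ) : ℝ) ^ α := by positivity
    linarith
  · have hj' : (0 : ℝ) < j := by exact_mod_cast hj
    have hn' : (0 : ℝ) < n := by exact_mod_cast hj.trans hjn.le
    have hnα : (0 : ℝ) < (n : ℝ) ^ α := by positivity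
    have h1 := min_one_mul_le_rpow_sub_rpow hα hn' (Nat.cast_nonneg (n - j))
      (by exact_mod_cast Nat.sub_le n j)
    rw [Nat.cast_sub hjn.le, sub_sub_cancel, ← Nat.cast_sub hjn.le] at h1
    have hpos : 0 < c * ((n : ℝ) ^ α * (j / n)) := by positivity
    have h2 := Real.log_le_log hpos h1
    rw [Real.log_mul hc0.ne' (by positivity), Real.log_mul hnα.ne' (by positivity),
      Real.log_div hj'.ne' hn'.ne'] at h2
    have h3 := iterLog_sub_le_log_sub_log hβ (hpos.trans_le h1)
      (show (n : ℝ) ^ α - ((n - j : ℕ) : ℝ) ^ α ≤ (n : ℝ) ^ α by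
        have : (0 : ℝ) ≤ ((n - j : ℕ) : ℝ) ^ α := by positivity
        linarith)
    rw [qB_eq hα]
    linarith

/-- Weights decreasing in `k` and bounded by `log^{(β)} n^α`, whose sum is equivalent to
`n log^{(β)} n^α`, turn convergence of the Fejér means into convergence of the weighted means. -/
theorem tendsto_sum_mul_div_sumQ_qB {α : ℝ} {β : ℕ} (hα : 0 < α) (hβ : 1 ≤ β) {b : ℕ → ℕ → ℝ}
    (hb0 : ∀ n, ∀ k ∈ Finset.Icc 1 n, 0 ≤ b n k)
    (hb : ∀ n i j, 1 ≤ i → i ≤ j → j ≤ n → b n j ≤ b n i)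
    (hb1 : ∀ n, 1 ≤ n → b n 1 ≤ qB α β n)
    (hsum : Tendsto (fun n : ℕ => (∑ k ∈ Finset.Icc 1 n, b n k) / (n * qB α β n)) atTop (𝓝 1))
    {s : ℕ → ℂ} {L : ℂ}
    (hs : Tendsto (fun n : ℕ => (∑ k ∈ Finset.Icc 1 n, s k) / (n : ℂ)) atTop (𝓝 L)) :
    Tendsto (fun n : ℕ => (∑ k ∈ Finset.Icc 1 n, (b n k : ℂ) * s k) / (sumQ (qB α β) n : ℂ))
      atTop (𝓝 L) := by
  have hQ := tendsto_sumQ_qB_div hα hβ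
  have hQ0 := sumQ_nonneg (qB_nonneg hα β)
  have hev : ∀ᶠ n : ℕ in atTop, 1 ≤ n ∧ 0 < qB α β n :=
    (eventually_ge_atTop 1).and ((tendsto_qB_atTop hα β).eventually_gt_atTop 0)
  have h := tendsto_sum_mul_of_tendsto_mean (w := fun n k => b n k / sumQ (qB α β) n)
    (fun n k hk => div_nonneg (hb0 n k hk) (hQ0 n))
    (fun n i j hi hij hj => div_le_div_of_nonneg_right (hb n i j hi hij hj) (hQ0 n)) ?_ ?_ hs
  · refine h.congr fun n => ?_
    rw [Finset.sum_div]
    refine Finset.sum_congr rfl fun k _ => ?_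
    push_cast
    ring
  · have h1 := hsum.div hQ one_ne_zero
    rw [div_one] at h1
    refine h1.congr' ?_
    filter_upwards [hev] with n ⟨hn, hqn⟩
    have hn' : (0 : ℝ) < n := by exact_mod_cast hn
    rw [Pi.div_apply, div_div_div_cancel_right₀ (by positivity), Finset.sum_div]
  · have h1 : Tendsto (fun n : ℕ => 1 / (n : ℝ) / (sumQ (qB α β) n / (n * qB α β n))) atTop
        (𝓝 0) := by
      have := ((tendsto_natCast_atTop_atTop (R := ℝ)).const_div_atTop 1).div hQ one_ne_zero
      rwa [zero_div] at this
    refine squeeze_zero' ?_ ?_ h1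
    · filter_upwards [hev] with n ⟨hn, _⟩
      exact div_nonneg (hb0 n 1 (Finset.mem_Icc.2 ⟨le_rfl, hn⟩)) (hQ0 n)
    · filter_upwards [hev] with n ⟨hn, hqn⟩
      have hn' : (0 : ℝ) < n := by exact_mod_cast hn
      have h2 : 1 / (n : ℝ) / (sumQ (qB α β) n / (n * qB α β n)) =
          qB α β n / sumQ (qB α β) n := by
        rw [div_div_eq_mul_div]
        congr 1
        field_simp
      rw [h2]
      exact div_le_div_of_nonneg_right (hb1 n hn) (hQ0 n)

theorem tendsto_BMean_of_tendsto_fejerMean {α : ℝ} {β : ℕ} (hα : 0 < α) (hβ : 1 ≤ β)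
    {f : Gm m → ℂ} {x : Gm m} {L : ℂ}
    (h : Tendsto (fun n : ℕ => fejerMean m n f x) atTop (𝓝 L)) :
    Tendsto (fun n : ℕ => BMean m α β n f x) atTop (𝓝 L) := by
  have hmono : ∀ i j : ℕ, i ≤ j → (i : ℝ) ^ α ≤ (j : ℝ) ^ α := fun i j hij => by gcongr
  refine tendsto_sum_mul_div_sumQ_qB hα hβ
    (b := fun n k => iterLog β ((n : ℝ) ^ α - (k : ℝ) ^ α))
    (fun n k hk => iterLog_nonneg β (sub_nonneg.2 (hmono k n (Finset.mem_Icc.1 hk).2)))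
    (fun n i j _ hij hj => iterLog_mono β (sub_nonneg.2 (hmono j n hj))
      (by linarith [hmono i j hij]))
    (fun n hn => ?_) (tendsto_sum_iterLog_sub_div hα hβ) h
  rw [qB_eq hα]
  refine iterLog_mono β (sub_nonneg.2 (hmono 1 n hn)) ?_
  simp

theorem tendsto_norlundMean_qB_of_tendsto_fejerMean {α : ℝ} {β : ℕ} (hα : 0 < α) (hβ : 1 ≤ β)
    {f : Gm m → ℂ} {x : Gm m} {L : ℂ}
    (h : Tendsto (fun n : ℕ => fejerMean m n f x) atTop (𝓝 L)) :
    Tendsto (fun n : ℕ => norlundMean m (qB α β) n f x) atTop (𝓝 L) := by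
  refine tendsto_sum_mul_div_sumQ_qB hα hβ (b := fun n k => qB α β (n - k))
    (fun n k _ => qB_nonneg hα β _) (fun n i j _ hij _ => qB_mono hα β (by omega))
    (fun n _ => qB_mono hα β (Nat.sub_le _ _)) ?_ h
  refine (tendsto_sumQ_qB_div hα hβ).congr fun n => ?_
  rw [sum_Icc_one_tsub, sumQ]

end Logarithmic

end Vilenkin

theorem mainTheorem3 (m : ℕ → ℕ) (hm : ∀ k, 2 ≤ m k) (hbdd : BddAbove (Set.range m))
    (p : ℝ≥0∞) (hp : 1 ≤ p) (f : Vilenkin.Gm m → ℂ) (hf : MemLp f p (Vilenkin.haar m)) :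
    (∀ᵐ x ∂(Vilenkin.haar m),
      Tendsto (fun n : ℕ => Vilenkin.fejerMean m n f x) atTop (𝓝 (f x))) ∧
    (∀ α : ℝ, 0 < α → α < 1 →
      (∀ᵐ x ∂(Vilenkin.haar m),
        Tendsto (fun n : ℕ => Vilenkin.cesaroMean m 1 α n f x) atTop (𝓝 (f x))) ∧
      (∀ᵐ x ∂(Vilenkin.haar m),
        Tendsto (fun n : ℕ => Vilenkin.cesaroMean m 0 α n f x) atTop (𝓝 (f x)))) ∧
    (∀ α : ℝ, 0 < α → α < 1 →
      (∀ᵐ x ∂(Vilenkin.haar m),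
        Tendsto (fun n : ℕ => Vilenkin.VMean m α n f x) atTop (𝓝 (f x))) ∧
      (∀ᵐ x ∂(Vilenkin.haar m),
        Tendsto (fun n : ℕ => Vilenkin.norlundMean m (Vilenkin.qV α) n f x) atTop (𝓝 (f x)))) ∧
    (∀ (α : ℝ) (β : ℕ), 0 < α → 1 ≤ β →
      (∀ᵐ x ∂(Vilenkin.haar m),
        Tendsto (fun n : ℕ => Vilenkin.BMean m α β n f x) atTop (𝓝 (f x))) ∧
      (∀ᵐ x ∂(Vilenkin.haar m),
        Tendsto (fun n : ℕ => Vilenkin.norlundMean m (Vilenkin.qB α β) n f x)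
          atTop (𝓝 (f x)))) := by
  have hf1 : Integrable f (Vilenkin.haar m) := by
    have := Vilenkin.isProbabilityMeasure_haar hm
    exact hf.integrable hp
  have hF := Vilenkin.ae_tendsto_fejerMean hm hbdd hf1
  refine ⟨hF, fun α h0 h1 => ⟨?_, ?_⟩, fun α h0 h1 => ?_, fun α β hα hβ => ⟨?_, ?_⟩⟩
  · exact Vilenkin.ae_tendsto_cesaroMean hm hbdd zero_le_one h0 h1.le hf1
  · exact Vilenkin.ae_tendsto_cesaroMean hm hbdd le_rfl h0 h1.le hf1
  · exact Vilenkin.ae_tendsto_VMean hm hbdd h0 h1.le hf1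
  · exact hF.mono fun x hx => Vilenkin.tendsto_BMean_of_tendsto_fejerMean hα hβ hx
  · exact hF.mono fun x hx => Vilenkin.tendsto_norlundMean_qB_of_tendsto_fejerMean hα hβ hx
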